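/- Let $f,g\in\mathbb{Q}[x]$ have no positive integer roots and let $(u_n)_{n\ge 0}$ be a sequence of rationals with $f(n)u_n=g(n)u_{n-1}$ for all $n\ge 1$. Suppose that $(u_n)$ is not of the form $u_n=q(n)$ with $q\in\mathbb{Q}(x)$, and that there is no bijection between the complex roots $\alpha$ of $f$ and the complex roots $\beta$ of $g$ (listed with multiplicity) such that $\mathbb{Q}(\alpha)=\mathbb{Q}(\beta)$ for all corresponding roots (i.e. $(u_n)$ is in class $\mathscr{D}$). Suppose in addition that one of the following holds: 1. every irreducible factor of $fg$ over $\mathbb{Q}$ has degree at most $2$; 2. $fg$ splits over a cyclotomic field $\mathbb{Q}(\zeta_N)$, $N\ge 1$, and the splitting field of $fg$ is a cyclic extension of $\mathbb{Q}$ (for instance, the splitting field is $\mathbb{Q}(\zeta_\ell)$ with $\ell$ prime). Call a prime $p$ a Hensel prime if $f$ and $g$ have $p$-integral coefficients and leading coefficients that are $p$-adic units, and the product of the distinct monic irreducible factors of $fg$ is squarefree modulo $p$. For such $p$ let $m_f,m_g$ be the numbers of roots of $f,g$ in $\mathbb{F}_p$, counted with multiplicity; $(u_n)$ is $p$-asymmetric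 if $p$ is a Hensel prime and $m_f\ne m_g$. Let $h$ be the logarithmic Weil height on $\mathbb{Q}$ and $\nu_p$ the $p$-adic valuation. Then $(u_n)$ is $p$-asymmetric for infinitely many primes $p$. Moreover, for every prime $p$ for which $(u_n)$ is $p$-asymmetric there is a constant $B$, depending only on $fg$ and $p$, such that for all $n\ge 0$ $$\Bigl|\nu_p(u_n)-\nu_p(u_0)-\frac{m_g-m_f}{p-1}\,n\Bigr|\le B\log(n+1),$$ and for all sufficiently large $n$ $$|\nu_p(u_n)|\ge \frac{|m_g-m_f|}{2(p-1)}\,n,\qquad h(u_n)\ge \frac{|m_g-m_f|\log p}{2(p-1)}\,n .$$ In particular $h(u_n)\gg n$, with an explicitly computable implied constant depending only on $fg$ and $p$. -/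

import Mathlib

open Polynomial

noncomputable section

/-- `u` satisfies `f(n) u(n) = g(n) u(n-1)` for all `n ≥ 1`, where neither coefficient
has a positive integer root. -/
structure IsHypergeometric (f g : ℚ[X]) (u : ℕ → ℚ) : Prop where
  f_ne_zero : ∀ n : ℕ, 1 ≤ n → f.eval (n : ℚ) ≠ 0
  g_ne_zero : ∀ n : ℕ, 1 ≤ n → g.eval (n : ℚ) ≠ 0
  recurrence : ∀ n : ℕ, 1 ≤ n → f.eval (n : ℚ) * u n = g.eval (n : ℚ) * u (n - 1)

/-- `u n = q(n)` for all `n`, for some rational function `q = a / b` over `ℚ`. -/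
def IsRationalSequence (u : ℕ → ℚ) : Prop :=
  ∃ a b : ℚ[X], (∀ n : ℕ, b.eval (n : ℚ) ≠ 0) ∧
    ∀ n : ℕ, u n = a.eval (n : ℚ) / b.eval (n : ℚ)

/-- There is a bijection between the complex roots of `f` and those of `g` (each listed with
multiplicity) such that corresponding roots generate the same subfield of `ℂ`. -/
def RootFieldsMatch (f g : ℚ[X]) : Prop :=
  Multiset.Rel
    (fun α β : ℂ => IntermediateField.adjoin ℚ {α} = IntermediateField.adjoin ℚ {β})
    (f.aroots ℂ) (g.aroots ℂ)

/-- The class `𝒟` of hypergeometric sequences, with their recurrence `f(n) u(n) = g(n) u(n-1)`. -/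
structure ClassD (f g : ℚ[X]) (u : ℕ → ℚ) : Prop where
  hypergeometric : IsHypergeometric f g u
  not_rational : ¬ IsRationalSequence u
  not_match : ¬ RootFieldsMatch f g

/-- Coefficientwise reduction modulo `p`; meaningful when all coefficients are `p`-integral. -/
def reduceMod (p : ℕ) [Fact p.Prime] (h : ℚ[X]) : (ZMod p)[X] :=
  h.sum fun i q => monomial i (q : ZMod p)

/-- The number of roots of `h` in `𝔽_p`, counted with multiplicity. -/
def rootCount (p : ℕ) [Fact p.Prime] (h : ℚ[X]) : ℕ :=
  (reduceMod p h).roots.card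

/-- `h` has `p`-integral coefficients, and its leading coefficient is a `p`-adic unit. -/
def HasGoodCoeffs (p : ℕ) (h : ℚ[X]) : Prop :=
  (∀ i, 0 ≤ padicValRat p (h.coeff i)) ∧ padicValRat p h.leadingCoeff = 0

/-- `p` is a Hensel prime for `f g`: both polynomials keep their degrees modulo `p`, and the
product of the distinct monic irreducible factors of `f g` stays squarefree modulo `p`, so that
roots modulo `p` lift uniquely to `p`-adic roots of the same multiplicity. -/
structure IsHenselPrime (p : ℕ) [Fact p.Prime] (f g : ℚ[X]) : Prop where
  good_f : HasGoodCoeffs p f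
  good_g : HasGoodCoeffs p g
  squarefree : Squarefree (reduceMod p (UniqueFactorizationMonoid.radical (f * g)))

/-- `p` is a Hensel prime for `f g` modulo which `f` and `g` have different numbers of roots. -/
def IsAsymmetric (p : ℕ) [Fact p.Prime] (f g : ℚ[X]) : Prop :=
  IsHenselPrime p f g ∧ rootCount p f ≠ rootCount p g

/-- The rate `(m_g - m_f) / (p - 1)`, with `m_f`, `m_g` the numbers of roots modulo `p`. -/
def valuationRate (p : ℕ) [Fact p.Prime] (f g : ℚ[X]) : ℝ :=
  ((rootCount p g : ℝ) - (rootCount p f : ℝ)) / ((p : ℝ) - 1)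

end

/-!
The valuation of `u n / u 0` is the sum over `1 ≤ k ≤ n` of the differences of the valuations of
`g(k)` and `f(k)`. At a Hensel prime, Hensel's lemma lets the roots of `f` and `g` modulo `p` be lifted to `p`-adic roots,
and the cofactors of these roots take unit values at integers
(`IsHenselPrime.exists_model_roots`), so that only the terms `k - α` with `α` a `p`-adic root
matter. Counting residue classes modulo the powers of `p`, each root contributes `n / (p - 1)` up to
one unit for each power of `p` that can occur. As `(k - α)` divides the value of `P = f g` at `k`,
which is nonzero and of polynomial size, there are `O(log n)` such powers, with a constant that
depends only on `P` and `p` (`exists_valuation_error_bound`). The lower bounds follow, since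
`|ν_p(q)| log p` never exceeds the height of `q`.

For the infinitude of asymmetric primes, `P` splits in a cyclotomic field `L`; when the irreducible
factors are at most quadratic this holds because quadratic Gauss sums express square roots of
integers through roots of unity. By Dirichlet's theorem every automorphism `σ` of `L` acts on roots
of unity as the `p`-th power for arbitrarily large primes `p`, and then the roots of `f` modulo `p`
are counted by the roots of `f` in `L` fixed by `σ` (`rootCount_eq_countP_fixed`). If almost no
prime were asymmetric, each `σ` would fix as many roots of `f` as of `g`. The multisets of
stabilizers of the roots of `f` and of `g` in the Galois group of `P` would then contain each
element equally often, and hence be equal: if the group is cyclic, by evaluation at generators of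
subgroups; if the stabilizers have index at most two, by linear independence of their sign
characters. Through the Galois correspondence this is a matching of the root fields, which is
excluded.
-/

noncomputable section

/-! ### Models of rational polynomials over the `p`-adic integers -/

/-- `H` is a model of the rational polynomial `h` over `ℤ_[p]`: the two agree over `ℚ_[p]`. -/
def IsPadicModel (p : ℕ) [Fact p.Prime] (h : ℚ[X]) (H : ℤ_[p][X]) : Prop :=
  H.map (algebraMap ℤ_[p] ℚ_[p]) = h.map (algebraMap ℚ ℚ_[p])

section Models

variable {p : ℕ} [Fact p.Prime]

theorem PadicInt.toZMod_eq_ratCast {x : ℤ_[p]} {q : ℚ} (h : (x : ℚ_[p]) = q) :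
    PadicInt.toZMod x = (q : ZMod p) := by
  have h1 : (x : ℚ_[p]) * (q.den : ℚ_[p]) = (q.num : ℚ_[p]) := by
    rw [h]; exact_mod_cast Rat.mul_den_eq_num q
  have h2 : x * (q.den : ℤ_[p]) = (q.num : ℤ_[p]) := PadicInt.ext (by push_cast; exact h1)
  have h3 := congrArg PadicInt.toZMod h2
  rw [map_mul, map_natCast, map_intCast] at h3
  -- The denominator is prime to `p`, since otherwise `p` would divide the numerator as well.
  have hden : ((q.den : ℕ) : ZMod p) ≠ 0 := by
    intro h0
    rw [h0, mul_zero] at h3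
    have hnum : p ∣ q.num.natAbs :=
      Int.natCast_dvd.mp ((ZMod.intCast_zmod_eq_zero_iff_dvd _ _).mp h3.symm)
    rw [ZMod.natCast_eq_zero_iff] at h0
    exact Nat.Prime.one_lt Fact.out |>.ne' (Nat.dvd_one.mp (q.reduced ▸ Nat.dvd_gcd hnum h0))
  rw [Rat.cast_def, eq_div_iff hden, h3]

theorem IsPadicModel.coe_coeff {h : ℚ[X]} {H : ℤ_[p][X]} (hH : IsPadicModel p h H) (i : ℕ) :
    (H.coeff i : ℚ_[p]) = (h.coeff i : ℚ) := by
  have := congrArg (fun P => P.coeff i) hH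
  rw [coeff_map, coeff_map] at this
  exact this

theorem exists_isPadicModel {h : ℚ[X]} (hh : ∀ i, 0 ≤ padicValRat p (h.coeff i)) :
    ∃ H : ℤ_[p][X], IsPadicModel p h H := by
  have : h.map (algebraMap ℚ ℚ_[p]) ∈ lifts (algebraMap ℤ_[p] ℚ_[p]) := by
    rw [lifts_iff_coeff_lifts]
    intro i
    have h1 : ‖((h.coeff i : ℚ) : ℚ_[p])‖ ≤ 1 := by
      rw [Padic.norm_le_one_iff_val_nonneg, Padic.valuation_ratCast]
      exact hh i
    exact ⟨⟨_, h1⟩, by rw [coeff_map]; rfl⟩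
  exact this

theorem coeff_reduceMod (h : ℚ[X]) (i : ℕ) : (reduceMod p h).coeff i = (h.coeff i : ZMod p) := by
  rw [reduceMod, Polynomial.sum_def, finsetSum_coeff]
  simp only [coeff_monomial]
  rw [Finset.sum_ite_eq']
  split_ifs with hi
  · rfl
  · rw [notMem_support_iff.mp hi, Rat.cast_zero]

theorem IsPadicModel.reduceMod_eq {h : ℚ[X]} {H : ℤ_[p][X]} (hH : IsPadicModel p h H) :
    reduceMod p h = H.map PadicInt.toZMod := by
  ext i
  rw [coeff_map, PadicInt.toZMod_eq_ratCast (hH.coe_coeff i), coeff_reduceMod]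

theorem IsPadicModel.mul {h k : ℚ[X]} {H K : ℤ_[p][X]} (hH : IsPadicModel p h H)
    (hK : IsPadicModel p k K) : IsPadicModel p (h * k) (H * K) := by
  unfold IsPadicModel at *
  rw [Polynomial.map_mul, Polynomial.map_mul, hH, hK]

theorem IsPadicModel.pow {h : ℚ[X]} {H : ℤ_[p][X]} (hH : IsPadicModel p h H) (m : ℕ) :
    IsPadicModel p (h ^ m) (H ^ m) := by
  unfold IsPadicModel at *
  rw [Polynomial.map_pow, Polynomial.map_pow, hH]

theorem IsPadicModel.coe_eval {h : ℚ[X]} {H : ℤ_[p][X]} (hH : IsPadicModel p h H) (n : ℕ) :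
    ((H.eval (n : ℤ_[p]) : ℤ_[p]) : ℚ_[p]) = (h.eval (n : ℚ) : ℚ) := by
  have := congrArg (fun P => P.eval (n : ℚ_[p])) hH
  change (H.map _).eval _ = (h.map _).eval _ at this
  rw [← map_natCast (algebraMap ℤ_[p] ℚ_[p]), eval_map_apply, map_natCast,
    ← map_natCast (algebraMap ℚ ℚ_[p]), eval_map_apply] at this
  exact this

theorem IsPadicModel.natDegree_eq {h : ℚ[X]} {H : ℤ_[p][X]} (hH : IsPadicModel p h H) :
    H.natDegree = h.natDegree := by
  rw [← natDegree_map_eq_of_injective (IsFractionRing.injective ℤ_[p] ℚ_[p]), hH,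
    natDegree_map_eq_of_injective (algebraMap ℚ ℚ_[p]).injective]

theorem IsPadicModel.isUnit_leadingCoeff {h : ℚ[X]} {H : ℤ_[p][X]} (hH : IsPadicModel p h H)
    (h0 : h ≠ 0) (hl : padicValRat p h.leadingCoeff = 0) : IsUnit H.leadingCoeff := by
  have h1 : (H.leadingCoeff : ℚ_[p]) = (h.leadingCoeff : ℚ) := by
    rw [leadingCoeff, hH.natDegree_eq, hH.coe_coeff]; rfl
  have h2 : ((h.leadingCoeff : ℚ) : ℚ_[p]) ≠ 0 := by
    exact_mod_cast leadingCoeff_ne_zero.mpr h0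
  rw [PadicInt.isUnit_iff, PadicInt.norm_def, h1, Padic.norm_eq_zpow_neg_valuation h2,
    Padic.valuation_ratCast, hl]
  simp

theorem HasGoodCoeffs.exists_model {h : ℚ[X]} (hh : HasGoodCoeffs p h) (h0 : h ≠ 0) :
    ∃ H : ℤ_[p][X], IsPadicModel p h H ∧ IsUnit H.leadingCoeff :=
  let ⟨H, hH⟩ := exists_isPadicModel hh.1
  ⟨H, hH, hH.isUnit_leadingCoeff h0 hh.2⟩

theorem Polynomial.exists_monic_of_isUnit_leadingCoeff {R : Type*} [CommRing R] {F : R[X]}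
    (hF : IsUnit F.leadingCoeff) : ∃ F' : R[X], F'.Monic ∧ Associated F F' := by
  obtain ⟨c, hc⟩ := hF
  refine ⟨F * C (↑c⁻¹ : R), ?_, ?_⟩
  · apply monic_mul_C_of_leadingCoeff_mul_eq_one
    rw [← hc, Units.mul_inv]
  · exact ⟨(c⁻¹).map (C : R →+* R[X]).toMonoidHom, rfl⟩

/-- Gauss's lemma: monic divisors of a polynomial with a model of unit leading coefficient
have a model. -/
theorem exists_model_of_dvd {h r : ℚ[X]} {H : ℤ_[p][X]} (hH : IsPadicModel p h H)
    (hl : IsUnit H.leadingCoeff) (hr : r.Monic) (hd : r ∣ h) :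
    ∃ R : ℤ_[p][X], IsPadicModel p r R ∧ R.Monic := by
  obtain ⟨H', hm, hass⟩ := exists_monic_of_isUnit_leadingCoeff hl
  have hd' : r.map (algebraMap ℚ ℚ_[p]) ∣ H'.map (algebraMap ℤ_[p] ℚ_[p]) := by
    refine (Polynomial.map_dvd _ hd).trans ?_
    rw [← hH]
    exact Polynomial.map_dvd _ hass.dvd
  obtain ⟨R, hR⟩ := IsIntegrallyClosed.eq_map_mul_C_of_dvd ℚ_[p] hm hd'
  rw [(hr.map _).leadingCoeff, C_1, mul_one] at hR
  refine ⟨R, hR, ?_⟩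
  refine monic_of_injective (IsFractionRing.injective ℤ_[p] ℚ_[p]) ?_
  rw [hR]
  exact hr.map _

theorem IsPadicModel.dvd {h k : ℚ[X]} {H K : ℤ_[p][X]} (hH : IsPadicModel p h H)
    (hK : IsPadicModel p k K) (hl : IsUnit H.leadingCoeff) (hd : h ∣ k) : H ∣ K := by
  obtain ⟨H', hm, hass⟩ := exists_monic_of_isUnit_leadingCoeff hl
  rw [hass.dvd_iff_dvd_left,
    ← Polynomial.map_dvd_map _ (IsFractionRing.injective ℤ_[p] ℚ_[p]) hm]
  refine (Polynomial.map_dvd _ hass.symm.dvd).trans ?_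
  rw [hH, hK]
  exact Polynomial.map_dvd _ hd

end Models

/-! ### Hensel lifting -/

section Hensel

variable {p : ℕ} [Fact p.Prime]

instance PadicInt.instHenselianLocalRing : HenselianLocalRing ℤ_[p] where
  is_henselian f hf a h1 h2 :=
    (IsAdicComplete.henselianRing ℤ_[p] (IsLocalRing.maximalIdeal ℤ_[p])).is_henselian f hf a h1
      (h2.map (Ideal.Quotient.mk (IsLocalRing.maximalIdeal ℤ_[p])))

theorem PadicInt.exists_isRoot_of_simple_root {R : ℤ_[p][X]} (hR : R.Monic) {a : ZMod p}
    (h1 : (R.map toZMod).eval a = 0) (h2 : (derivative (R.map toZMod)).eval a ≠ 0) :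
    ∃ α : ℤ_[p], R.IsRoot α ∧ toZMod α = a := by
  obtain ⟨a, rfl⟩ := ZMod.ringHom_surjective (toZMod : ℤ_[p] →+* ZMod p) a
  rw [eval_map_apply] at h1
  rw [derivative_map, eval_map_apply] at h2
  obtain ⟨α, hα, hαa⟩ := HenselianLocalRing.is_henselian R hR a
    (by rwa [← ker_toZMod, RingHom.mem_ker])
    (by rwa [← IsLocalRing.notMem_maximalIdeal, ← ker_toZMod, RingHom.mem_ker])
  refine ⟨α, hα, ?_⟩
  rwa [← ker_toZMod, RingHom.mem_ker, map_sub, sub_eq_zero] at hαa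

theorem Polynomial.derivative_eval_ne_zero_of_squarefree {k : Type*} [Field k] {R : k[X]}
    (hs : Squarefree R) {a : k} (ha : R.eval a = 0) : (derivative R).eval a ≠ 0 := by
  intro h
  have h1 := (one_lt_rootMultiplicity_iff_isRoot hs.ne_zero).mpr ⟨ha, h⟩
  have h2 : (X - C a) * (X - C a) ∣ R := by
    rw [← sq]
    exact (pow_dvd_pow _ h1).trans (pow_rootMultiplicity_dvd R a)
  exact (prime_X_sub_C a).not_isUnit (hs _ h2)

/-- A divisor of a power of a monic polynomial which is squarefree modulo `p` has a root in `ℤ_[p]`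
as soon as it has one modulo `p`. -/
theorem PadicInt.eval_map_toZMod_ne_zero {R F : ℤ_[p][X]} (hR : R.Monic)
    (hs : Squarefree (R.map toZMod)) {m : ℕ} (hd : F ∣ R ^ m) (hF : ∀ α, ¬ F.IsRoot α)
    (a : ZMod p) : (F.map toZMod).eval a ≠ 0 := by
  have hdvd {A B : ℤ_[p][X]} (h : A ∣ B) (h0 : (A.map toZMod).eval a = 0) :
      (B.map toZMod).eval a = 0 := by
    obtain ⟨C, rfl⟩ := h
    rw [Polynomial.map_mul, eval_mul, h0, zero_mul]
  intro h0
  have h1 : (R.map toZMod).eval a = 0 := by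
    have := hdvd hd h0
    rw [Polynomial.map_pow, eval_pow] at this
    exact eq_zero_of_pow_eq_zero this
  have h2 := derivative_eval_ne_zero_of_squarefree hs h1
  obtain ⟨α, hα, rfl⟩ := exists_isRoot_of_simple_root hR h1 h2
  obtain ⟨R₁, hR₁⟩ := dvd_iff_isRoot.mpr hα
  have h3 : (R₁.map toZMod).eval (toZMod α) ≠ 0 := by
    intro h
    apply h2
    rw [hR₁, Polynomial.map_mul, derivative_mul, eval_add, eval_mul, eval_mul, h]
    simp
  -- `X - α` does not divide `F`, so it can be cancelled from `R ^ m`.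
  have h4 : F ∣ R₁ ^ m := by
    obtain ⟨Q, hQ⟩ := hd
    have h5 : (X - C α) ^ m ∣ F * Q := by
      rw [← hQ, hR₁, mul_pow]; exact dvd_mul_right _ _
    obtain ⟨Q', rfl⟩ := (prime_X_sub_C α).pow_dvd_of_dvd_mul_left m
      (fun h => hF α (dvd_iff_isRoot.mp h)) h5
    refine ⟨Q', mul_left_cancel₀ (pow_ne_zero m (X_sub_C_ne_zero α)) ?_⟩
    rw [← mul_pow, ← hR₁, hQ]; ring
  apply h3
  have := hdvd h4 h0
  rw [Polynomial.map_pow, eval_pow] at this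
  exact eq_zero_of_pow_eq_zero this

end Hensel

/-! ### Averages of valuations of differences -/

section Counting

theorem Nat.abs_card_Ioc_filter_modEq_sub_le (n : ℕ) {r : ℕ} (hr : 0 < r) (v : ℕ) :
    |((({x ∈ Finset.Ioc 0 n | x ≡ v [MOD r]}.card : ℕ) : ℝ)) - n / r| ≤ 1 := by
  have h := Nat.Ioc_filter_modEq_card 0 n hr v
  set c := {x ∈ Finset.Ioc 0 n | x ≡ v [MOD r]}.card
  set A : ℚ := (n - v) / r with hA
  set B : ℚ := ((0 : ℕ) - v) / r with hB
  have hr' : (0 : ℚ) < r := by exact_mod_cast hr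
  have hAB : A = B + n / r := by rw [hA, hB]; field_simp; push_cast; ring
  have hn : (0 : ℚ) ≤ n / r := by positivity
  have hfl : ⌊B⌋ ≤ ⌊A⌋ := Int.floor_le_floor (by linarith)
  rw [max_eq_left (by linarith)] at h
  have hc : (c : ℚ) = ⌊A⌋ - ⌊B⌋ := by exact_mod_cast h
  have key : |(c : ℚ) - n / r| ≤ 1 := by
    have h1 := Int.floor_le A
    have h2 := Int.lt_floor_add_one A
    have h3 := Int.floor_le B
    have h4 := Int.lt_floor_add_one B
    rw [abs_le]
    constructor <;> linarith
  have := (Rat.cast_le (K := ℝ)).mpr key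
  push_cast at this
  exact this

variable {p : ℕ} [Fact p.Prime]

theorem PadicInt.le_valuation_iff_modEq {α : ℤ_[p]} {k : ℕ} (hk : (k : ℤ_[p]) ≠ α) (j : ℕ) :
    j ≤ ((k : ℤ_[p]) - α).valuation ↔ k ≡ α.appr j [MOD p ^ j] := by
  rw [← mem_span_pow_iff_le_valuation _ (sub_ne_zero.mpr hk)]
  have h1 : (k : ℤ_[p]) - α = ((k : ℤ_[p]) - (α.appr j : ℕ)) - (α - (α.appr j : ℕ)) := by ring
  rw [h1, Submodule.sub_mem_iff_left _ (appr_spec j α), Ideal.mem_span_singleton,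
    Nat.ModEq.comm, Nat.modEq_iff_dvd]
  have := pow_p_dvd_int_iff (p := p) j ((k : ℤ) - (α.appr j : ℕ))
  push_cast at this ⊢
  exact this

/-- On average `k - α` has valuation `1 / (p - 1)`: the integers `k ≤ n` with `p ^ j ∣ k - α` form a
residue class modulo `p ^ j`, for each of the at most `J` relevant values of `j`. -/
theorem PadicInt.abs_sum_valuation_sub_le {α : ℤ_[p]} {n J : ℕ} (hn : n ≤ p ^ J)
    (hα : ∀ k ∈ Finset.Ioc 0 n, (k : ℤ_[p]) ≠ α ∧ ((k : ℤ_[p]) - α).valuation ≤ J) :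
    |(∑ k ∈ Finset.Ioc 0 n, (((k : ℤ_[p]) - α).valuation : ℝ)) - n / ((p : ℝ) - 1)| ≤ J + 1 := by
  have hp1 : (1 : ℝ) < p := by exact_mod_cast (Fact.out : p.Prime).one_lt
  have hsum : (∑ k ∈ Finset.Ioc 0 n, (((k : ℤ_[p]) - α).valuation : ℝ)) =
      ∑ j ∈ Finset.Ioc 0 J,
        (({k ∈ Finset.Ioc 0 n | k ≡ α.appr j [MOD p ^ j]}.card : ℕ) : ℝ) := by
    have h1 : ∀ k ∈ Finset.Ioc 0 n, (((k : ℤ_[p]) - α).valuation : ℝ) =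
        ∑ j ∈ Finset.Ioc 0 J, if k ≡ α.appr j [MOD p ^ j] then (1 : ℝ) else 0 := by
      intro k hk
      rw [← Finset.sum_filter, Finset.sum_const, nsmul_one]
      have h2 : {j ∈ Finset.Ioc 0 J | k ≡ α.appr j [MOD p ^ j]} =
          Finset.Ioc 0 ((k : ℤ_[p]) - α).valuation := by
        ext j
        rw [Finset.mem_filter, Finset.mem_Ioc, Finset.mem_Ioc,
          ← le_valuation_iff_modEq (hα k hk).1]
        have := (hα k hk).2
        omega
      rw [h2, Nat.card_Ioc, Nat.sub_zero]
    rw [Finset.sum_congr rfl h1, Finset.sum_comm]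
    refine Finset.sum_congr rfl fun j _ => ?_
    rw [← Finset.sum_filter, Finset.sum_const, nsmul_one]
  have hgeom : ∀ J : ℕ, ∑ j ∈ Finset.Ioc 0 J, (n : ℝ) / ((p ^ j : ℕ) : ℝ) =
      n / ((p : ℝ) - 1) - n / ((p : ℝ) ^ J * (p - 1)) := by
    intro J
    induction J with
    | zero => simp
    | succ J ih =>
      rw [← Finset.insert_Ioc_right_eq_Ioc_add_one (Nat.zero_le J), Finset.sum_insert (by simp), ih]
      have h1 : (p : ℝ) - 1 ≠ 0 := by linarith
      have h2 : (p : ℝ) ≠ 0 := by linarith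
      push_cast
      field_simp
      ring
  have hterm : |(∑ j ∈ Finset.Ioc 0 J,
        (({k ∈ Finset.Ioc 0 n | k ≡ α.appr j [MOD p ^ j]}.card : ℕ) : ℝ)) -
      ∑ j ∈ Finset.Ioc 0 J, (n : ℝ) / ((p ^ j : ℕ) : ℝ)| ≤ J := by
    rw [← Finset.sum_sub_distrib]
    refine (Finset.abs_sum_le_sum_abs _ _).trans ?_
    refine (Finset.sum_le_card_nsmul _ _ 1 fun j _ => ?_).trans_eq (by simp)
    exact Nat.abs_card_Ioc_filter_modEq_sub_le n
      (pow_pos (Fact.out : p.Prime).pos j) _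
  have htail : |(n : ℝ) / ((p : ℝ) ^ J * (p - 1))| ≤ 1 := by
    have h2 : (1 : ℝ) ≤ p - 1 := by
      have : (2 : ℝ) ≤ p := by exact_mod_cast (Fact.out : p.Prime).two_le
      linarith
    have h3 : (n : ℝ) ≤ (p : ℝ) ^ J := by exact_mod_cast hn
    rw [abs_of_nonneg (by positivity), div_le_one (by positivity)]
    calc (n : ℝ) ≤ (p : ℝ) ^ J * 1 := by linarith
      _ ≤ _ := by gcongr
  rw [hsum]
  rw [hgeom J] at hterm
  rw [abs_le] at *
  constructor <;> linarith [hterm.1, hterm.2, htail.1, htail.2]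

end Counting

/-! ### Growth of valuations of polynomial values -/

section Growth

/-- The valuation of the values of a fixed polynomial grows at most logarithmically. -/
theorem exists_padicValRat_eval_le (P : ℚ[X]) (p : ℕ) [Fact p.Prime] :
    ∃ C : ℝ, 0 ≤ C ∧ ∀ n : ℕ, 1 ≤ n → P.eval (n : ℚ) ≠ 0 →
      (padicValRat p (P.eval (n : ℚ)) : ℝ) ≤ C * Real.log ((n : ℝ) + 1) := by
  obtain ⟨D, hD, hQ⟩ := IsLocalization.integerNormalization_spec (nonZeroDivisors ℤ) P
  set Q := IsLocalization.integerNormalization (nonZeroDivisors ℤ) P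
  have hD0 : D ≠ 0 := nonZeroDivisors.ne_zero hD
  have heval (n : ℕ) : ((Q.eval (n : ℤ) : ℤ) : ℚ) = D * P.eval (n : ℚ) := by
    have := congrArg (eval (n : ℚ)) hQ
    rw [← map_natCast (algebraMap ℤ ℚ), eval_map_apply, map_natCast, eval_smul, zsmul_eq_mul] at this
    exact this
  set A : ℝ := 1 + ∑ i ∈ Finset.range (Q.natDegree + 1), |(Q.coeff i : ℝ)| with hA
  have hA1 : 1 ≤ A := by
    rw [hA, le_add_iff_nonneg_right]; exact Finset.sum_nonneg fun _ _ => abs_nonneg _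
  have hbound (n : ℕ) : |((Q.eval (n : ℤ) : ℤ) : ℝ)| ≤ A * ((n : ℝ) + 1) ^ Q.natDegree := by
    rw [eval_eq_sum_range]
    push_cast
    refine (Finset.abs_sum_le_sum_abs _ _).trans ?_
    have hs : ∑ i ∈ Finset.range (Q.natDegree + 1), |(Q.coeff i : ℝ)| ≤ A := by rw [hA]; linarith
    refine le_trans ?_ (mul_le_mul_of_nonneg_right hs (by positivity))
    rw [Finset.sum_mul]
    refine Finset.sum_le_sum fun i hi => ?_
    rw [abs_mul, abs_of_nonneg (by positivity : (0 : ℝ) ≤ (n : ℝ) ^ i)]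
    refine mul_le_mul_of_nonneg_left ?_ (abs_nonneg _)
    calc (n : ℝ) ^ i ≤ ((n : ℝ) + 1) ^ i := by gcongr; linarith
      _ ≤ ((n : ℝ) + 1) ^ Q.natDegree :=
        pow_le_pow_right₀ (by linarith [Nat.cast_nonneg (α := ℝ) n])
          (Nat.lt_succ_iff.mp (Finset.mem_range.mp hi))
  have hp1 : (1 : ℝ) < p := by exact_mod_cast (Fact.out : p.Prime).one_lt
  have hlp : 0 < Real.log p := Real.log_pos hp1
  have hl2 : 0 < Real.log 2 := Real.log_pos one_lt_two
  have hlA : 0 ≤ Real.log A := Real.log_nonneg hA1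
  refine ⟨(Real.log A / Real.log 2 + Q.natDegree) / Real.log p, by positivity, fun n hn h0 => ?_⟩
  have hv : padicValRat p (P.eval (n : ℚ)) ≤ (padicValInt p (Q.eval (n : ℤ)) : ℤ) := by
    rw [← padicValRat.of_int, heval, padicValRat.mul (by exact_mod_cast hD0) h0, padicValRat.of_int]
    exact le_add_of_nonneg_left (Int.natCast_nonneg _)
  have hQ0 : Q.eval (n : ℤ) ≠ 0 := by
    intro h
    have := heval n
    rw [h, Int.cast_zero, eq_comm, mul_eq_zero] at this
    exact this.elim (by exact_mod_cast hD0) h0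
  have hle : (p : ℝ) ^ padicValInt p (Q.eval (n : ℤ)) ≤ |((Q.eval (n : ℤ) : ℤ) : ℝ)| := by
    have h1 := Int.le_of_dvd (abs_pos.mpr hQ0) ((dvd_abs _ _).mpr
      (padicValInt_dvd (p := p) (Q.eval (n : ℤ))))
    exact_mod_cast h1
  have hlog := Real.log_le_log (by positivity) (hle.trans (hbound n))
  rw [Real.log_pow, Real.log_mul (by positivity) (by positivity), Real.log_pow] at hlog
  have hl2n : Real.log 2 ≤ Real.log ((n : ℝ) + 1) := by
    apply Real.log_le_log two_pos
    have : (1 : ℝ) ≤ n := by exact_mod_cast hn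
    linarith
  have hlA' : Real.log A ≤ Real.log A / Real.log 2 * Real.log ((n : ℝ) + 1) := by
    calc Real.log A = Real.log A / Real.log 2 * Real.log 2 := by field_simp
      _ ≤ _ := by gcongr
  have hv' : (padicValRat p (P.eval (n : ℚ)) : ℝ) ≤ (padicValInt p (Q.eval (n : ℤ)) : ℝ) := by
    exact_mod_cast hv
  refine hv'.trans ?_
  rw [div_mul_eq_mul_div, le_div_iff₀ hlp]
  linarith

end Growth

/-! ### Valuations of polynomial values in terms of `p`-adic roots -/

section Roots

variable {p : ℕ} [Fact p.Prime]

theorem PadicInt.valuation_eq_zero_of_toZMod_ne_zero {x : ℤ_[p]} (hx : toZMod x ≠ 0) :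
    x.valuation = 0 := by
  have hu : IsUnit x := by
    rwa [← IsLocalRing.notMem_maximalIdeal, ← ker_toZMod, RingHom.mem_ker]
  by_contra h
  have h0 : x ≠ 0 := fun h0 => hx (by rw [h0, map_zero])
  have h1 := (mem_span_pow_iff_le_valuation x h0 1).mpr (Nat.one_le_iff_ne_zero.mpr h)
  rw [pow_one, ← maximalIdeal_eq_span_p] at h1
  exact (IsLocalRing.notMem_maximalIdeal.mpr hu) h1

theorem PadicInt.valuation_multiset_prod_sub (s : Multiset ℤ_[p]) (x : ℤ_[p])
    (hs : ∀ α ∈ s, x ≠ α) :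
    ((s.map fun α => x - α).prod).valuation = (s.map fun α => (x - α).valuation).sum := by
  induction s using Multiset.induction_on with
  | empty => simp
  | cons a s ih =>
    have hs' : ∀ α ∈ s, x ≠ α := fun α hα => hs α (Multiset.mem_cons_of_mem hα)
    rw [Multiset.map_cons, Multiset.prod_cons, Multiset.map_cons, Multiset.sum_cons,
      valuation_mul (sub_ne_zero.mpr (hs a (Multiset.mem_cons_self a s))), ih hs']
    rw [Ne, Multiset.prod_eq_zero_iff]
    exact fun h => let ⟨α, hα, h0⟩ := Multiset.mem_map.mp h; hs' α hα (sub_eq_zero.mp h0)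

theorem monic_radical {P : ℚ[X]} : (UniqueFactorizationMonoid.radical P).Monic := by
  refine monic_prod_of_monic _ _ fun q hq => ?_
  rw [UniqueFactorizationMonoid.mem_primeFactors] at hq
  have h1 := UniqueFactorizationMonoid.normalize_normalized_factor q hq
  have h2 := (UniqueFactorizationMonoid.irreducible_of_normalized_factor q hq).ne_zero
  rw [← h1]
  exact monic_normalize h2

theorem HasGoodCoeffs.mul_model {f g : ℚ[X]} (hf : HasGoodCoeffs p f) (hg : HasGoodCoeffs p g)
    (hf0 : f ≠ 0) (hg0 : g ≠ 0) :
    ∃ H : ℤ_[p][X], IsPadicModel p (f * g) H ∧ IsUnit H.leadingCoeff := by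
  obtain ⟨F, hF, hFu⟩ := hf.exists_model hf0
  obtain ⟨G, hG, hGu⟩ := hg.exists_model hg0
  exact ⟨F * G, hF.mul hG, by rw [leadingCoeff_mul]; exact hFu.mul hGu⟩

/-- At a Hensel prime, the roots modulo `p` of a divisor of `f g` are the reductions of its `p`-adic
roots, and only these contribute to the valuations of its values. -/
theorem IsHenselPrime.exists_model_roots {f g h : ℚ[X]} (hp : IsHenselPrime p f g)
    (hf : f ≠ 0) (hg : g ≠ 0) (hh : HasGoodCoeffs p h) (hd : h ∣ f * g) :
    ∃ H : ℤ_[p][X], IsPadicModel p h H ∧ rootCount p h = H.roots.card ∧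
      ∀ n : ℕ, h.eval (n : ℚ) ≠ 0 → padicValRat p (h.eval (n : ℚ)) =
        ((H.roots.map fun α => ((n : ℤ_[p]) - α).valuation).sum : ℕ) := by
  have hfg : f * g ≠ 0 := mul_ne_zero hf hg
  obtain ⟨E, hE, hEu⟩ := hp.good_f.mul_model hp.good_g hf hg
  obtain ⟨R, hR, hRm⟩ := exists_model_of_dvd hE hEu monic_radical
    UniqueFactorizationMonoid.radical_dvd_self
  have hs := hp.squarefree
  rw [hR.reduceMod_eq] at hs
  have h0 : h ≠ 0 := ne_zero_of_dvd_ne_zero hfg hd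
  obtain ⟨H, hH, hHu⟩ := hh.exists_model h0
  obtain ⟨m, hm⟩ := UniqueFactorizationMonoid.exists_dvd_radical_self_pow hfg
  have hHR : H ∣ R ^ m := hH.dvd (hR.pow m) hHu (hd.trans hm)
  obtain ⟨Q, hQ, -, hQr⟩ := exists_prod_multiset_X_sub_C_mul H
  have hH0 : H ≠ 0 := fun h => by simp [h] at hHu
  have hQ0 : Q ≠ 0 := fun h => hH0 (by rw [← hQ, h, mul_zero])
  have hQroot : ∀ a, (Q.map PadicInt.toZMod).eval a ≠ 0 := by
    refine PadicInt.eval_map_toZMod_ne_zero hRm hs ((Dvd.intro_left _ hQ).trans hHR)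
      fun α hα => ?_
    have := (mem_roots hQ0).mpr hα
    simp [hQr] at this
  refine ⟨H, hH, ?_, fun n hn => ?_⟩
  · have hQ0' : Q.map PadicInt.toZMod ≠ 0 := fun h => hQroot 0 (by rw [h, eval_zero])
    have hmap : H.map PadicInt.toZMod =
        (((H.roots.map PadicInt.toZMod).map fun a => X - C a).prod) * Q.map PadicInt.toZMod := by
      conv_lhs => rw [← hQ]
      rw [Polynomial.map_mul, Polynomial.map_multiset_prod, Multiset.map_map, Multiset.map_map]
      congr 3
      funext a
      simp
    have hQr' : (Q.map PadicInt.toZMod).roots = 0 := by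
      refine Multiset.eq_zero_of_forall_notMem fun a ha => hQroot a ?_
      exact (mem_roots hQ0').mp ha
    rw [rootCount, hH.reduceMod_eq, hmap, roots_mul, roots_multiset_prod_X_sub_C, hQr', add_zero,
      Multiset.card_map]
    exact mul_ne_zero (monic_multisetProd_X_sub_C _).ne_zero hQ0'
  · have hne : ∀ α ∈ H.roots, (n : ℤ_[p]) ≠ α := by
      rintro α hα rfl
      have h1 := hH.coe_eval n
      rw [(mem_roots hH0).mp hα] at h1
      exact hn (Rat.cast_injective (α := ℚ_[p]) (by rw [← h1, Rat.cast_zero]; rfl))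
    have hQv : (Q.eval (n : ℤ_[p])).valuation = 0 := by
      apply PadicInt.valuation_eq_zero_of_toZMod_ne_zero
      have := hQroot (n : ZMod p)
      rwa [← map_natCast PadicInt.toZMod, eval_map_apply] at this
    have hQn : Q.eval (n : ℤ_[p]) ≠ 0 := by
      intro h
      have := hQroot (n : ZMod p)
      rw [← map_natCast PadicInt.toZMod, eval_map_apply, h, map_zero] at this
      exact this rfl
    have heval : H.eval (n : ℤ_[p]) =
        (H.roots.map fun α => (n : ℤ_[p]) - α).prod * Q.eval (n : ℤ_[p]) := by
      conv_lhs => rw [← hQ]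
      rw [eval_mul, eval_multiset_prod, Multiset.map_map]
      congr 3
      funext a
      simp
    have hprod : (H.roots.map fun α => (n : ℤ_[p]) - α).prod ≠ 0 := by
      rw [Ne, Multiset.prod_eq_zero_iff]
      exact fun h => let ⟨α, hα, h0⟩ := Multiset.mem_map.mp h; hne α hα (sub_eq_zero.mp h0)
    rw [← Padic.valuation_ratCast, ← hH.coe_eval n, PadicInt.valuation_coe, heval,
      PadicInt.valuation_mul hprod hQn, hQv, add_zero, PadicInt.valuation_multiset_prod_sub _ _ hne]

end Roots

/-! ### Valuations and heights of hypergeometric sequences -/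

section Asymptotics

theorem IsHypergeometric.f_nonzero {f g : ℚ[X]} {u : ℕ → ℚ} (h : IsHypergeometric f g u) :
    f ≠ 0 := fun h0 => h.f_ne_zero 1 le_rfl (by rw [h0, eval_zero])

theorem IsHypergeometric.g_nonzero {f g : ℚ[X]} {u : ℕ → ℚ} (h : IsHypergeometric f g u) :
    g ≠ 0 := fun h0 => h.g_ne_zero 1 le_rfl (by rw [h0, eval_zero])

theorem ClassD.ne_zero {f g : ℚ[X]} {u : ℕ → ℚ} (h : ClassD f g u) (n : ℕ) : u n ≠ 0 := by
  induction n with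
  | zero =>
    intro h0
    have hz : ∀ n, u n = 0 := by
      intro n
      induction n with
      | zero => exact h0
      | succ n ih =>
        have := h.hypergeometric.recurrence (n + 1) (by omega)
        rw [Nat.add_sub_cancel, ih, mul_zero, mul_eq_zero] at this
        exact this.resolve_left (h.hypergeometric.f_ne_zero (n + 1) (by omega))
    exact h.not_rational ⟨0, 1, by simp, by simp [hz]⟩
  | succ n ih =>
    intro h0
    have := h.hypergeometric.recurrence (n + 1) (by omega)
    rw [Nat.add_sub_cancel, h0, mul_zero, eq_comm, mul_eq_zero] at this
    exact this.elim (h.hypergeometric.g_ne_zero (n + 1) (by omega)) ih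

variable {p : ℕ} [Fact p.Prime]

theorem ClassD.padicValRat_eq {f g : ℚ[X]} {u : ℕ → ℚ} (h : ClassD f g u) (n : ℕ) :
    (padicValRat p (u n) : ℝ) = padicValRat p (u 0) +
      (∑ k ∈ Finset.Ioc 0 n, (padicValRat p (g.eval (k : ℚ)) : ℝ) -
        ∑ k ∈ Finset.Ioc 0 n, (padicValRat p (f.eval (k : ℚ)) : ℝ)) := by
  induction n with
  | zero => simp
  | succ n ih =>
    have h1 := h.hypergeometric.recurrence (n + 1) (by omega)
    rw [Nat.add_sub_cancel] at h1
    have h2 := congrArg (padicValRat p) h1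
    rw [padicValRat.mul (h.hypergeometric.f_ne_zero _ (by omega)) (h.ne_zero _),
      padicValRat.mul (h.hypergeometric.g_ne_zero _ (by omega)) (h.ne_zero _)] at h2
    rw [← Finset.insert_Ioc_right_eq_Ioc_add_one (Nat.zero_le n), Finset.sum_insert (by simp),
      Finset.sum_insert (by simp)]
    have h3 : (padicValRat p (f.eval ((n + 1 : ℕ) : ℚ)) : ℝ) + padicValRat p (u (n + 1)) =
        padicValRat p (g.eval ((n + 1 : ℕ) : ℚ)) + padicValRat p (u n) := by exact_mod_cast h2
    linarith

/-- The average valuation of `k - α` at a root `α` of `P`, with an error term in which only `P`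
and `p` enter, through the bound `C` for the valuations of the values of `P`. -/
theorem PadicInt.abs_sum_valuation_sub_le_log {P : ℚ[X]} {E : ℤ_[p][X]} (hE : IsPadicModel p P E)
    (hP : ∀ k : ℕ, 1 ≤ k → P.eval (k : ℚ) ≠ 0) {C : ℝ} (hC0 : 0 ≤ C)
    (hC : ∀ n : ℕ, 1 ≤ n → P.eval (n : ℚ) ≠ 0 →
      (padicValRat p (P.eval (n : ℚ)) : ℝ) ≤ C * Real.log ((n : ℝ) + 1))
    {α : ℤ_[p]} (hα : E.IsRoot α) {n : ℕ} (hn : 1 ≤ n) :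
    |(∑ k ∈ Finset.Ioc 0 n, (((k : ℤ_[p]) - α).valuation : ℝ)) - n / ((p : ℝ) - 1)| ≤
      (C + 1 / Real.log p + 2 / Real.log 2) * Real.log ((n : ℝ) + 1) := by
  have hp1 : (1 : ℝ) < p := by exact_mod_cast (Fact.out : p.Prime).one_lt
  have hlp : 0 < Real.log p := Real.log_pos hp1
  have hl2 : 0 < Real.log 2 := Real.log_pos one_lt_two
  have hn1 : (1 : ℝ) ≤ n := by exact_mod_cast hn
  set ℓ := Real.log ((n : ℝ) + 1) with hℓ
  have hl2n : Real.log 2 ≤ ℓ := Real.log_le_log two_pos (by linarith)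
  have hl0 : 0 ≤ ℓ := hl2.le.trans hl2n
  have hlp' : 0 < 1 / Real.log p := by positivity
  -- `J` bounds the valuations that occur, and `n ≤ p ^ J`.
  set J := ⌈(C + 1 / Real.log p) * ℓ⌉₊ with hJ
  have hJ1 : (C + 1 / Real.log p) * ℓ ≤ J := Nat.le_ceil _
  have hJ2 : (J : ℝ) ≤ (C + 1 / Real.log p) * ℓ + 1 := (Nat.ceil_lt_add_one (by positivity)).le
  have hnJ : n ≤ p ^ J := by
    have h1 : ℓ ≤ J * Real.log p := by
      have h2 : (1 / Real.log p) * ℓ ≤ J := by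
        refine le_trans ?_ hJ1
        exact mul_le_mul_of_nonneg_right (by linarith) hl0
      calc ℓ = (1 / Real.log p) * ℓ * Real.log p := by field_simp
        _ ≤ _ := by gcongr
    rw [← Real.log_pow, hℓ, Real.log_le_log_iff (by positivity) (by positivity)] at h1
    have h3 : (n : ℝ) ≤ (p : ℝ) ^ J := by linarith
    exact_mod_cast h3
  have hk : ∀ k ∈ Finset.Ioc 0 n, (k : ℤ_[p]) ≠ α ∧ ((k : ℤ_[p]) - α).valuation ≤ J := by
    intro k hk
    obtain ⟨hk0, hkn⟩ := Finset.mem_Ioc.mp hk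
    have hPk := hP k hk0
    have hEk : E.eval (k : ℤ_[p]) ≠ 0 := by
      intro h
      have h1 := hE.coe_eval k
      rw [h] at h1
      exact hPk (Rat.cast_injective (α := ℚ_[p]) (by rw [← h1, Rat.cast_zero]; rfl))
    have hne : (k : ℤ_[p]) ≠ α := by rintro rfl; exact hEk hα
    refine ⟨hne, ?_⟩
    obtain ⟨Q, hQ⟩ := dvd_iff_isRoot.mpr hα
    have h1 : E.eval (k : ℤ_[p]) = ((k : ℤ_[p]) - α) * Q.eval (k : ℤ_[p]) := by
      conv_lhs => rw [hQ]
      simp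
    have h2 : Q.eval (k : ℤ_[p]) ≠ 0 := fun h => hEk (by rw [h1, h, mul_zero])
    have h3 := valuation_mul (sub_ne_zero.mpr hne) h2
    have h4 : padicValRat p (P.eval (k : ℚ)) = (E.eval (k : ℤ_[p])).valuation := by
      rw [← Padic.valuation_ratCast, ← hE.coe_eval k, valuation_coe]
    have h5 := hC k hk0 hPk
    rw [h4, h1, h3] at h5
    have h6 : Real.log ((k : ℝ) + 1) ≤ ℓ := by
      apply Real.log_le_log (by positivity)
      have : (k : ℝ) ≤ n := by exact_mod_cast hkn
      linarith
    have h7 : (((k : ℤ_[p]) - α).valuation : ℝ) ≤ J := by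
      push_cast at h5
      have h8 : (0 : ℝ) ≤ (Q.eval (k : ℤ_[p])).valuation := Nat.cast_nonneg _
      have h9 : C * Real.log ((k : ℝ) + 1) ≤ (C + 1 / Real.log p) * ℓ := by
        have : (0 : ℝ) ≤ 1 / Real.log p := by positivity
        apply mul_le_mul (by linarith) h6 (Real.log_nonneg (by linarith [Nat.cast_nonneg (α := ℝ) k]))
          (by positivity)
      linarith
    exact_mod_cast h7
  refine (abs_sum_valuation_sub_le hnJ hk).trans ?_
  have h2 : 2 ≤ 2 / Real.log 2 * ℓ := by
    calc (2 : ℝ) = 2 / Real.log 2 * Real.log 2 := by field_simp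
      _ ≤ _ := by gcongr
  linarith

theorem Multiset.sum_map_finset_sum {ι κ M : Type*} [AddCommMonoid M] (s : Multiset ι)
    (t : Finset κ) (v : κ → ι → M) :
    (s.map fun i => ∑ k ∈ t, v k i).sum = ∑ k ∈ t, (s.map (v k)).sum := by
  induction s using Multiset.induction_on with
  | empty => simp
  | cons a s ih => simp [ih, Finset.sum_add_distrib]

theorem Multiset.abs_sum_map_sub_le {ι : Type*} (s : Multiset ι) (v : ι → ℝ) (c e : ℝ)
    (h : ∀ i ∈ s, |v i - c| ≤ e) : |(s.map v).sum - s.card * c| ≤ s.card * e := by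
  induction s using Multiset.induction_on with
  | empty => simp
  | cons a s ih =>
    have h1 := h a (Multiset.mem_cons_self a s)
    have h2 := ih fun i hi => h i (Multiset.mem_cons_of_mem hi)
    rw [Multiset.map_cons, Multiset.sum_cons, Multiset.card_cons]
    push_cast
    rw [abs_le] at *
    constructor <;> linarith [h1.1, h1.2, h2.1, h2.2]

/-- The constant of the logarithmic error term depends only on `f * g` and on `p`. -/
theorem exists_valuation_error_bound (P : ℚ[X]) (p : ℕ) [Fact p.Prime] :
    ∃ B : ℝ, ∀ (f g : ℚ[X]) (u : ℕ → ℚ), f * g = P → ClassD f g u → IsHenselPrime p f g →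
      ∀ n : ℕ, |(padicValRat p (u n) : ℝ) - (padicValRat p (u 0) : ℝ)
        - valuationRate p f g * (n : ℝ)| ≤ B * Real.log ((n : ℝ) + 1) := by
  obtain ⟨C, hC0, hC⟩ := exists_padicValRat_eval_le P p
  set B := C + 1 / Real.log p + 2 / Real.log 2 with hB
  refine ⟨P.natDegree * B, fun f g u hfg hu hp n => ?_⟩
  rcases Nat.eq_zero_or_pos n with rfl | hn
  · simp
  have hf := hu.hypergeometric.f_nonzero
  have hg := hu.hypergeometric.g_nonzero
  obtain ⟨F, hF, hFr, hFv⟩ := hp.exists_model_roots hf hg hp.good_f (dvd_mul_right f g)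
  obtain ⟨G, hG, hGr, hGv⟩ := hp.exists_model_roots hf hg hp.good_g (dvd_mul_left g f)
  have hE : IsPadicModel p P (F * G) := hfg ▸ hF.mul hG
  have hP : ∀ k : ℕ, 1 ≤ k → P.eval (k : ℚ) ≠ 0 := fun k hk => by
    rw [← hfg, eval_mul]
    exact mul_ne_zero (hu.hypergeometric.f_ne_zero k hk) (hu.hypergeometric.g_ne_zero k hk)
  have hsum (h : ℚ[X]) (H : ℤ_[p][X]) (hdvd : H ∣ F * G)
      (h0 : ∀ k : ℕ, 1 ≤ k → h.eval (k : ℚ) ≠ 0)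
      (hv : ∀ n : ℕ, h.eval (n : ℚ) ≠ 0 → padicValRat p (h.eval (n : ℚ)) =
        ((H.roots.map fun α => ((n : ℤ_[p]) - α).valuation).sum : ℕ)) :
      |(∑ k ∈ Finset.Ioc 0 n, (padicValRat p (h.eval (k : ℚ)) : ℝ)) -
        H.roots.card * (n / ((p : ℝ) - 1))| ≤ H.roots.card * (B * Real.log ((n : ℝ) + 1)) := by
    have h1 : (∑ k ∈ Finset.Ioc 0 n, (padicValRat p (h.eval (k : ℚ)) : ℝ)) =
        (H.roots.map fun α =>
          ∑ k ∈ Finset.Ioc 0 n, (((k : ℤ_[p]) - α).valuation : ℝ)).sum := by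
      rw [Multiset.sum_map_finset_sum]
      refine Finset.sum_congr rfl fun k hk => ?_
      rw [hv k (h0 k (Finset.mem_Ioc.mp hk).1), Int.cast_natCast, Nat.cast_multiset_sum,
        Multiset.map_map]
      rfl
    rw [h1]
    refine Multiset.abs_sum_map_sub_le _ _ _ _ fun α hα => ?_
    exact PadicInt.abs_sum_valuation_sub_le_log hE hP hC0 hC
      ((isRoot_of_mem_roots hα).dvd hdvd) hn
  have h1 := hsum f F (dvd_mul_right F G) hu.hypergeometric.f_ne_zero hFv
  have h2 := hsum g G (dvd_mul_left G F) hu.hypergeometric.g_ne_zero hGv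
  have hrate : valuationRate p f g * n =
      G.roots.card * (n / ((p : ℝ) - 1)) - F.roots.card * (n / ((p : ℝ) - 1)) := by
    rw [valuationRate, hFr, hGr]; ring
  have hdeg : (F.roots.card : ℝ) + G.roots.card ≤ P.natDegree := by
    have h3 := card_roots' F
    have h4 := card_roots' G
    have h5 : P.natDegree = f.natDegree + g.natDegree := by rw [← hfg, natDegree_mul hf hg]
    rw [hF.natDegree_eq] at h3
    rw [hG.natDegree_eq] at h4
    exact_mod_cast (by omega : F.roots.card + G.roots.card ≤ P.natDegree)
  have hpos : 0 ≤ B * Real.log ((n : ℝ) + 1) := by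
    have hp1 : (1 : ℝ) < p := by exact_mod_cast (Fact.out : p.Prime).one_lt
    have hlp : 0 < Real.log p := Real.log_pos hp1
    have hl2 : 0 < Real.log 2 := Real.log_pos one_lt_two
    have := Real.log_nonneg (by linarith [Nat.cast_nonneg (α := ℝ) n] : (1 : ℝ) ≤ n + 1)
    positivity
  have hle := mul_le_mul_of_nonneg_right hdeg hpos
  rw [hu.padicValRat_eq n, hrate, mul_assoc]
  rw [abs_le] at *
  constructor <;> linarith [h1.1, h1.2, h2.1, h2.2]

/-- The `p`-adic valuation of a rational number is bounded by its height. -/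
theorem abs_padicValRat_mul_log_le_logHeight₁ (p : ℕ) [Fact p.Prime] {q : ℚ} (hq : q ≠ 0) :
    |(padicValRat p q : ℝ)| * Real.log p ≤ Height.logHeight₁ q := by
  have hlog (a : ℕ) (ha : a ≠ 0) (hm : a ≤ max q.num.natAbs q.den) :
      (padicValNat p a : ℝ) * Real.log p ≤ Height.logHeight₁ q := by
    have hp0 : (0 : ℝ) < p := by exact_mod_cast (Fact.out : p.Prime).pos
    rw [Rat.logHeight₁_eq_log_max, ← Real.log_pow]
    apply Real.log_le_log (by positivity)
    have := Nat.le_of_dvd (Nat.pos_of_ne_zero ha) (pow_padicValNat_dvd (p := p) (n := a))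
    exact_mod_cast this.trans hm
  have h1 := hlog q.num.natAbs (Int.natAbs_ne_zero.mpr (Rat.num_ne_zero.mpr hq)) (le_max_left _ _)
  have h2 := hlog q.den q.den_nz (le_max_right _ _)
  have hl : 0 ≤ Real.log p := Real.log_natCast_nonneg p
  have hv : (padicValRat p q : ℝ) =
      (padicValNat p q.num.natAbs : ℝ) - (padicValNat p q.den : ℝ) := by
    rw [padicValRat_def, padicValInt, Int.cast_sub, Int.cast_natCast, Int.cast_natCast]
  have h3 : 0 ≤ (padicValNat p q.num.natAbs : ℝ) * Real.log p := by positivity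
  have h4 : 0 ≤ (padicValNat p q.den : ℝ) * Real.log p := by positivity
  rw [← abs_of_nonneg hl, ← abs_mul, hv, sub_mul, abs_le]
  constructor <;> linarith

theorem valuationRate_ne_zero {f g : ℚ[X]} (h : IsAsymmetric p f g) : valuationRate p f g ≠ 0 := by
  have hp1 : (1 : ℝ) < p := by exact_mod_cast (Fact.out : p.Prime).one_lt
  refine div_ne_zero (sub_ne_zero.mpr ?_) (by linarith)
  exact_mod_cast h.2.symm

/-- If `v n` is linear with slope `c ≠ 0` up to a logarithmic error, then it eventually exceeds half
its main term in absolute value. -/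
theorem exists_half_mul_le_abs {v : ℕ → ℝ} {c B : ℝ} (hc : c ≠ 0)
    (h : ∀ n : ℕ, |v n - v 0 - c * n| ≤ B * Real.log ((n : ℝ) + 1)) :
    ∃ n₀ : ℕ, ∀ n : ℕ, n₀ ≤ n → |c| / 2 * n ≤ |v n| := by
  have h1 : Filter.Tendsto (fun n : ℕ => (|v 0| + |B| * Real.log ((n : ℝ) + 1)) / n)
      Filter.atTop (nhds 0) := by
    have h2 : Filter.Tendsto (fun n : ℕ => Real.log ((n : ℝ) + 1) / n) Filter.atTop (nhds 0) := by
      have h3 := (Real.tendsto_pow_log_div_mul_add_atTop 1 (-1) 1 one_ne_zero).comp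
        (Filter.tendsto_atTop_add_const_right Filter.atTop (1 : ℝ) tendsto_natCast_atTop_atTop)
      refine h3.congr fun n => ?_
      simp
    have h4 := (tendsto_const_div_atTop_nhds_zero_nat |v 0|).add (h2.const_mul |B|)
    rw [mul_zero, add_zero] at h4
    refine h4.congr fun n => ?_
    ring
  have hc2 : 0 < |c| / 2 := by positivity
  obtain ⟨n₀, hn₀⟩ := Filter.eventually_atTop.mp
    ((h1.eventually (gt_mem_nhds hc2)).and (Filter.eventually_gt_atTop 0))
  refine ⟨n₀, fun n hn => ?_⟩
  obtain ⟨h2, h3⟩ := hn₀ n hn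
  have h3' : (0 : ℝ) < n := by exact_mod_cast h3
  rw [div_lt_iff₀ h3'] at h2
  have h4 := h n
  have h5 : B * Real.log ((n : ℝ) + 1) ≤ |B| * Real.log ((n : ℝ) + 1) :=
    mul_le_mul_of_nonneg_right (le_abs_self B) (Real.log_nonneg (by linarith))
  have h6 : |c| * n = |c * n| := by rw [abs_mul, abs_of_pos h3']
  have h7 : |c * n| ≤ |v n| + |v 0| + |v n - v 0 - c * n| := by
    calc |c * n| = |v n - v 0 - (v n - v 0 - c * n)| := by congr 1; ring
      _ ≤ |v n - v 0| + |v n - v 0 - c * n| := abs_sub _ _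
      _ ≤ _ := by gcongr; exact abs_sub _ _
  linarith

end Asymptotics

/-! ### Multisets of subgroups -/

section Subgroups

variable {G : Type*} [Group G]

open Classical in
theorem Multiset.countP_mem_eq_sum [Fintype (Subgroup G)] (A : Multiset (Subgroup G)) (g : G) :
    A.countP (g ∈ ·) = ∑ H : Subgroup G, if g ∈ H then A.count H else 0 := by
  rw [countP_eq_card_filter, ← sum_count_eq_card (s := Finset.univ) (by simp)]
  simp [count_filter]

variable [Finite G]

open Classical in
/-- A multiset of subgroups of a finite cyclic group is determined by the number of its members
containing each element: the generators of `H` lie exactly in the subgroups containing `H`. -/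
theorem Multiset.eq_of_countP_mem_eq_of_isCyclic [IsCyclic G] {A B : Multiset (Subgroup G)}
    (h : ∀ g : G, A.countP (g ∈ ·) = B.countP (g ∈ ·)) : A = B := by
  have := Fintype.ofFinite (Subgroup G)
  by_contra hAB
  have hne : (Finset.univ.filter fun H : Subgroup G => A.count H ≠ B.count H).Nonempty := by
    by_contra hempty
    refine hAB (Multiset.ext.mpr fun H => ?_)
    by_contra hH
    exact hempty ⟨H, by simpa using hH⟩
  obtain ⟨H, hmax⟩ := Finset.exists_maximal hne
  obtain ⟨g, hg⟩ := (Subgroup.isCyclic_iff_exists_zpowers_eq_top H).mp inferInstance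
  have hmem (K : Subgroup G) : g ∈ K ↔ H ≤ K := by rw [← hg, Subgroup.zpowers_le]
  have hH : A.count H ≠ B.count H := by simpa using hmax.prop
  have key := h g
  rw [countP_mem_eq_sum, countP_mem_eq_sum, ← Finset.add_sum_erase _ _ (Finset.mem_univ H),
    ← Finset.add_sum_erase _ _ (Finset.mem_univ H)] at key
  have hrest : (∑ K ∈ Finset.univ.erase H, if g ∈ K then A.count K else 0) =
      ∑ K ∈ Finset.univ.erase H, if g ∈ K then B.count K else 0 := by
    refine Finset.sum_congr rfl fun K hK => ?_
    split_ifs with hgK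
    · by_contra hne'
      have hHK := (hmem K).mp hgK
      exact (Finset.mem_erase.mp hK).1 (le_antisymm (hmax.le_of_ge (by simpa using hne') hHK) hHK)
    · rfl
  rw [hrest, if_pos ((hmem H).mpr le_rfl), if_pos ((hmem H).mpr le_rfl)] at key
  exact hH (Nat.add_right_cancel key)

open Classical in
/-- The sign character with kernel `H`, for a subgroup `H` of index at most two; it is trivial if
`H = ⊤`. -/
def Subgroup.signChar (H : Subgroup G) (hH : H.index ≤ 2) : G →* ℚ where
  toFun g := if g ∈ H then 1 else -1
  map_one' := by simp [H.one_mem]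
  map_mul' a b := by
    have h0 : H.index ≠ 0 := Subgroup.index_ne_zero_of_finite
    rcases (by omega : H.index = 1 ∨ H.index = 2) with h | h
    · rw [Subgroup.index_eq_one] at h; simp [h]
    · have := Subgroup.mul_mem_iff_of_index_two h (a := a) (b := b)
      by_cases ha : a ∈ H <;> by_cases hb : b ∈ H <;> simp [this, ha, hb]

open Classical in
theorem Subgroup.signChar_apply (H : Subgroup G) (hH : H.index ≤ 2) (g : G) :
    H.signChar hH g = if g ∈ H then 1 else -1 := rfl

open Classical in
/-- A multiset of subgroups of index at most two is determined by the number of its members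
containing each element, by linear independence of characters. -/
theorem Multiset.eq_of_countP_mem_eq_of_index_le_two {A B : Multiset (Subgroup G)}
    (hA : ∀ H ∈ A, H.index ≤ 2) (hB : ∀ H ∈ B, H.index ≤ 2)
    (h : ∀ g : G, A.countP (g ∈ ·) = B.countP (g ∈ ·)) : A = B := by
  have := Fintype.ofFinite (Subgroup G)
  set c : Subgroup G → ℚ := fun H => A.count H - B.count H with hc
  have hc0 (H : Subgroup G) (hH : ¬ H.index ≤ 2) : c H = 0 := by
    rw [hc]
    simp [Multiset.count_eq_zero.mpr fun h => hH (hA H h),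
      Multiset.count_eq_zero.mpr fun h => hH (hB H h)]
  have hsum (g : G) : ∑ H : Subgroup G, (if g ∈ H then c H else 0) = 0 := by
    have h1 : (A.countP (g ∈ ·) : ℚ) = B.countP (g ∈ ·) := by rw [h g]
    rw [countP_mem_eq_sum, countP_mem_eq_sum] at h1
    push_cast at h1
    rw [← sub_eq_zero, ← Finset.sum_sub_distrib] at h1
    refine Eq.trans ?_ h1
    refine Finset.sum_congr rfl fun H _ => ?_
    by_cases hg : g ∈ H <;> simp only [if_pos, if_neg, hg, not_false_eq_true, sub_zero, hc]
  let T := {H : Subgroup G // H.index ≤ 2}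
  let χ : T → (G →* ℚ) := fun H => H.1.signChar H.2
  have hχ : Function.Injective χ := by
    intro H K hHK
    refine Subtype.ext (Subgroup.ext fun g => ?_)
    have h1 := DFunLike.congr_fun hHK g
    simp only [χ, Subgroup.signChar_apply] at h1
    by_cases h2 : g ∈ H.1 <;> by_cases h3 : g ∈ K.1 <;> simp [h2, h3] at h1 ⊢ <;> norm_num at h1
  have hli := Fintype.linearIndependent_iff.mp ((linearIndependent_monoidHom G ℚ).comp χ hχ)
  have htop : (⊤ : Subgroup G).index ≤ 2 := by simp
  let top : T := ⟨⊤, htop⟩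
  set s : ℚ := ∑ H : T, c H.1 with hs
  -- The membership indicator of `H` is `(1 + χ_H) / 2`, and the constant `1` is the character of `⊤`.
  have h0 := hli (fun H => c H.1 + if H = top then s else 0) (by
    funext g
    have h1 : ∑ H : T, (if g ∈ H.1 then c H.1 else 0) = 0 := by
      refine Eq.trans ?_ (hsum g)
      rw [← Finset.sum_subtype (p := fun H : Subgroup G => H.index ≤ 2)
        (Finset.univ.filter fun H : Subgroup G => H.index ≤ 2)
        (by simp) (fun H => if g ∈ H then c H else 0)]
      refine Finset.sum_filter_of_ne fun H _ hne => ?_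
      by_contra hH
      simp [hc0 H hH] at hne
    simp only [Finset.sum_apply, Pi.smul_apply, smul_eq_mul, Function.comp, add_mul,
      Finset.sum_add_distrib, ite_mul, zero_mul, Pi.zero_apply]
    have h2 : χ top g = 1 := by simp [χ, top, Subgroup.signChar_apply]
    have h3 : ∑ H : T, c H.1 * χ H g = 2 * ∑ H : T, (if g ∈ H.1 then c H.1 else 0) - s := by
      rw [hs, Finset.mul_sum, ← Finset.sum_sub_distrib]
      refine Finset.sum_congr rfl fun H _ => ?_
      simp only [χ, Subgroup.signChar_apply]
      split_ifs <;> ring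
    rw [h3, h1, Finset.sum_eq_single top (fun H _ hH => if_neg hH) (by simp), if_pos rfl, h2]
    ring)
  have hne (H : T) (hH : H ≠ top) : c H.1 = 0 := by simpa [hH] using h0 H
  have hs_eq : s = c ⊤ := by
    rw [hs, Finset.sum_eq_single top (fun H _ hH => hne H hH) (by simp)]
  have htop0 : c ⊤ = 0 := by
    have := h0 top
    simp only [if_true] at this
    rw [hs_eq] at this
    change c ⊤ + c ⊤ = 0 at this
    linarith
  refine Multiset.ext.mpr fun H => ?_
  have hcH : c H = 0 := by
    by_cases hH : H.index ≤ 2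
    · by_cases hT : (⟨H, hH⟩ : T) = top
      · have : H = ⊤ := congrArg Subtype.val hT
        rw [this, htop0]
      · exact hne ⟨H, hH⟩ hT
    · exact hc0 H hH
  rw [hc] at hcH
  exact_mod_cast sub_eq_zero.mp hcH

end Subgroups

/-! ### Quadratic irrationalities in cyclotomic fields -/

section Quadratic

/-- The field generated by the `N`-th roots of unity inside `ℂ`. -/
def rootsOfUnityField (N : ℕ) : IntermediateField ℚ ℂ :=
  IntermediateField.adjoin ℚ {z : ℂ | z ^ N = 1}

theorem mem_rootsOfUnityField {N : ℕ} {z : ℂ} (hz : z ^ N = 1) : z ∈ rootsOfUnityField N :=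
  IntermediateField.subset_adjoin _ _ hz

theorem rootsOfUnityField_mono {M N : ℕ} (h : M ∣ N) :
    rootsOfUnityField M ≤ rootsOfUnityField N := by
  obtain ⟨k, rfl⟩ := h
  refine IntermediateField.adjoin.mono _ _ _ fun z hz => ?_
  change z ^ (M * k) = 1
  rw [pow_mul, show z ^ M = 1 from hz, one_pow]

/-- By the quadratic Gauss sum, `√p` or `√(-p)` is a combination of `p`-th roots of unity. -/
theorem exists_sq_eq_prime {p : ℕ} (hp : p.Prime) (hp2 : p ≠ 2) :
    ∃ w ∈ rootsOfUnityField p, w ^ 2 = (p : ℂ) ∨ w ^ 2 = -(p : ℂ) := by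
  have : Fact p.Prime := ⟨hp⟩
  set χ : MulChar (ZMod p) ℂ := (quadraticChar (ZMod p)).ringHomComp (Int.castRingHom ℂ) with hχ
  have h1 : χ ≠ 1 := (MulChar.ringHomComp_ne_one_iff (RingHom.injective_int _)).mpr
    (quadraticChar_ne_one (by rwa [ZMod.ringChar_zmod_n]))
  have h2 : χ.IsQuadratic := (quadraticChar_isQuadratic (ZMod p)).comp _
  have h3 := gaussSum_sq h1 h2 (ZMod.isPrimitive_stdAddChar p)
  refine ⟨gaussSum χ ZMod.stdAddChar, ?_, ?_⟩
  · refine sum_mem fun a _ => mul_mem ?_ (mem_rootsOfUnityField ?_)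
    · rcases h2 a with h | h | h <;> rw [h]
      · exact zero_mem _
      · exact one_mem _
      · exact neg_mem (one_mem _)
    · rw [← AddChar.map_nsmul_eq_pow]
      simp
  · rw [ZMod.card] at h3
    rcases h2 (-1) with h | h | h
    · exact absurd h ((isUnit_one.neg.map χ).ne_zero)
    · left; rw [h3, h, one_mul]
    · right; rw [h3, h, neg_one_mul]

theorem I_mem_rootsOfUnityField : Complex.I ∈ rootsOfUnityField 4 :=
  mem_rootsOfUnityField Complex.I_pow_four

theorem exists_sq_eq_natCast (a : ℕ) : ∃ N : ℕ, 0 < N ∧ ∃ w ∈ rootsOfUnityField N, w ^ 2 = (a : ℂ) := by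
  induction a using Nat.recOnMul with
  | zero => exact ⟨1, one_pos, 0, zero_mem _, by simp⟩
  | one => exact ⟨1, one_pos, 1, one_mem _, by simp⟩
  | prime p hp =>
    by_cases hp2 : p = 2
    · subst hp2
      have hζ := Complex.isPrimitiveRoot_exp 8 (by norm_num)
      set ζ := Complex.exp (2 * Real.pi * Complex.I / (8 : ℕ))
      have hmem : ζ ∈ rootsOfUnityField 8 := mem_rootsOfUnityField hζ.pow_eq_one
      have h4 : ζ ^ 4 = -1 := by
        have h1 : (ζ ^ 4 - 1) * (ζ ^ 4 + 1) = 0 := by linear_combination hζ.pow_eq_one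
        have h2 : ζ ^ 4 - 1 ≠ 0 :=
          sub_ne_zero.mpr (hζ.pow_ne_one_of_pos_of_lt (by norm_num) (by norm_num))
        linear_combination (mul_eq_zero.mp h1).resolve_left h2
      refine ⟨8, by norm_num, ζ + ζ ^ 7, add_mem hmem (pow_mem hmem 7), ?_⟩
      push_cast
      linear_combination (ζ ^ 2 + 2 * (ζ ^ 4 - 1) + ζ ^ 6 * (ζ ^ 4 - 1)) * h4
    · obtain ⟨w, hw, h | h⟩ := exists_sq_eq_prime hp hp2
      · exact ⟨p, hp.pos, w, hw, h⟩
      · refine ⟨4 * p, by have := hp.pos; omega, Complex.I * w,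
          mul_mem (rootsOfUnityField_mono (dvd_mul_right _ _) I_mem_rootsOfUnityField)
            (rootsOfUnityField_mono (dvd_mul_left _ _) hw), ?_⟩
        rw [mul_pow, h, Complex.I_sq]; ring
  | mul a b ha hb =>
    obtain ⟨M, hM, v, hv, hva⟩ := ha
    obtain ⟨N, hN, w, hw, hwb⟩ := hb
    refine ⟨M * N, Nat.mul_pos hM hN, v * w,
      mul_mem (rootsOfUnityField_mono (dvd_mul_right _ _) hv)
        (rootsOfUnityField_mono (dvd_mul_left _ _) hw), ?_⟩
    rw [mul_pow, hva, hwb]; push_cast; ring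

/-- Square roots of integers are combinations of roots of unity. -/
theorem exists_mem_rootsOfUnityField_of_sq_eq_intCast {z : ℂ} {m : ℤ} (hz : z ^ 2 = m) :
    ∃ N : ℕ, 0 < N ∧ z ∈ rootsOfUnityField N := by
  obtain ⟨N, hN, w, hw, hwm⟩ := exists_sq_eq_natCast m.natAbs
  rcases Int.natAbs_eq m with h | h
  · have h1 : z ^ 2 = w ^ 2 := by rw [hz, hwm, h]; simp
    rcases sq_eq_sq_iff_eq_or_eq_neg.mp h1 with rfl | rfl
    · exact ⟨N, hN, hw⟩
    · exact ⟨N, hN, neg_mem hw⟩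
  · have hw' : Complex.I * w ∈ rootsOfUnityField (4 * N) :=
      mul_mem (rootsOfUnityField_mono (dvd_mul_right _ _) I_mem_rootsOfUnityField)
        (rootsOfUnityField_mono (dvd_mul_left _ _) hw)
    have h1 : z ^ 2 = (Complex.I * w) ^ 2 := by
      rw [hz, mul_pow, hwm, Complex.I_sq, h]; push_cast; simp
    rcases sq_eq_sq_iff_eq_or_eq_neg.mp h1 with rfl | rfl
    · exact ⟨4 * N, by omega, hw'⟩
    · exact ⟨4 * N, by omega, neg_mem hw'⟩

theorem exists_mem_rootsOfUnityField_of_natDegree_le_two {z : ℂ} (hz : IsIntegral ℚ z)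
    (hdeg : (minpoly ℚ z).natDegree ≤ 2) : ∃ N : ℕ, 0 < N ∧ z ∈ rootsOfUnityField N := by
  set m := minpoly ℚ z with hm
  have h0 := minpoly.aeval ℚ z
  have hmon := minpoly.monic hz
  have hpos := minpoly.natDegree_pos hz
  rw [aeval_eq_sum_range] at h0
  rw [← hm] at h0 hmon hpos
  rcases (by omega : m.natDegree = 1 ∨ m.natDegree = 2) with h | h
  · have hc : m.coeff 1 = 1 := by rw [← h]; exact hmon
    rw [h, Finset.sum_range_succ, Finset.sum_range_one, hc] at h0
    refine ⟨1, one_pos, ?_⟩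
    have hz' : z = algebraMap ℚ ℂ (-m.coeff 0) := by
      simp only [pow_zero, pow_one, Algebra.smul_def, mul_one, map_one, one_mul] at h0
      rw [map_neg]; linear_combination h0
    rw [hz']
    exact IntermediateField.algebraMap_mem _ _
  · have hc : m.coeff 2 = 1 := by rw [← h]; exact hmon
    rw [h, Finset.sum_range_succ, Finset.sum_range_succ, Finset.sum_range_one, hc] at h0
    simp only [pow_zero, pow_one, Algebra.smul_def, mul_one, eq_ratCast] at h0
    set b := m.coeff 1
    set c := m.coeff 0
    set q := b ^ 2 - 4 * c with hq
    -- The discriminant, multiplied by the square of its denominator, is an integer.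
    have hden : (q.den : ℂ) ≠ 0 := by exact_mod_cast q.den_nz
    have hqd : (q : ℂ) * q.den = q.num := by exact_mod_cast Rat.mul_den_eq_num q
    have hsq : ((q.den : ℂ) * (2 * z + b)) ^ 2 = ((q.num * q.den : ℤ) : ℂ) := by
      push_cast
      rw [← hqd, hq]
      push_cast
      linear_combination (4 * (q.den : ℂ) ^ 2) * h0
    obtain ⟨N, hN, hw⟩ := exists_mem_rootsOfUnityField_of_sq_eq_intCast hsq
    refine ⟨N, hN, ?_⟩
    have hz' : z = (((q.den : ℂ) * (2 * z + b)) / q.den - b) / 2 := by field_simp; ring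
    rw [hz']
    have hcast (r : ℚ) : (r : ℂ) ∈ rootsOfUnityField N := IntermediateField.algebraMap_mem _ r
    exact div_mem (sub_mem (div_mem hw (by exact_mod_cast hcast q.den)) (hcast b))
      (by exact_mod_cast hcast 2)

/-- A polynomial whose irreducible factors are at most quadratic splits in a cyclotomic field. -/
theorem exists_splits_cyclotomicField_of_natDegree_le_two {P : ℚ[X]} (hP0 : P ≠ 0)
    (hP : ∀ q : ℚ[X], Irreducible q → q ∣ P → q.natDegree ≤ 2) :
    ∃ N : ℕ, 0 < N ∧ (P.map (algebraMap ℚ (CyclotomicField N ℚ))).Splits := by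
  have hroot : ∀ z ∈ P.rootSet ℂ, ∃ N : ℕ, 0 < N ∧ z ∈ rootsOfUnityField N := by
    intro z hz
    have hz0 := aeval_eq_zero_of_mem_rootSet hz
    have hint : IsIntegral ℚ z := isAlgebraic_iff_isIntegral.mp ⟨P, hP0, hz0⟩
    exact exists_mem_rootsOfUnityField_of_natDegree_le_two hint
      (hP _ (minpoly.irreducible hint) (minpoly.dvd ℚ z hz0))
  have hfin : ∀ s : Finset ℂ, (∀ z ∈ s, ∃ N : ℕ, 0 < N ∧ z ∈ rootsOfUnityField N) →
      ∃ N : ℕ, 0 < N ∧ ∀ z ∈ s, z ∈ rootsOfUnityField N := by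
    intro s
    induction s using Finset.induction_on with
    | empty => exact fun _ => ⟨1, one_pos, by simp⟩
    | insert a s _ ih =>
      intro h
      obtain ⟨M, hM, ha⟩ := h a (Finset.mem_insert_self a s)
      obtain ⟨N, hN, hs⟩ := ih fun z hz => h z (Finset.mem_insert_of_mem hz)
      refine ⟨M * N, Nat.mul_pos hM hN, fun z hz => ?_⟩
      rcases Finset.mem_insert.mp hz with rfl | hz
      · exact rootsOfUnityField_mono (dvd_mul_right _ _) ha
      · exact rootsOfUnityField_mono (dvd_mul_left _ _) (hs z hz)
  obtain ⟨N, hN, hs⟩ := hfin (P.rootSet_finite ℂ).toFinset fun z hz =>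
    hroot z ((Set.Finite.mem_toFinset _).mp hz)
  have : NeZero N := ⟨hN.ne'⟩
  have : NeZero (N : ℚ) := ⟨by exact_mod_cast hN.ne'⟩
  have : IsCyclotomicExtension {N} ℚ (CyclotomicField N ℚ) :=
    CyclotomicField.isCyclotomicExtension N ℚ
  refine ⟨N, hN, ?_⟩
  obtain ⟨e⟩ := IsCyclotomicExtension.nonempty_algEquiv_adjoin_of_isSepClosed {N} ℚ
    (CyclotomicField N ℚ) ℂ
  have hsplit := IntermediateField.splits_of_splits
    (F := IntermediateField.adjoin ℚ {x : ℂ | ∃ n ∈ ({N} : Set ℕ), n ≠ 0 ∧ x ^ n = 1})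
    (IsAlgClosed.splits (P.map (algebraMap ℚ ℂ))) (fun z hz => by
      have h1 := hs z ((Set.Finite.mem_toFinset _).mpr hz)
      refine IntermediateField.adjoin.mono _ _ _ (fun w hw => ?_) h1
      exact ⟨N, rfl, hN.ne', hw⟩)
  have := hsplit.map e.symm.toAlgHom.toRingHom
  rwa [Polynomial.map_map, AlgHom.toRingHom_eq_coe, AlgHom.comp_algebraMap] at this

end Quadratic

/-! ### Reduction modulo a prime above `p` -/

section Reduction

/-- Reduction modulo a prime of `L` above `p`: a ring homomorphism from a subring of `L`, containing
all elements that are integral at `p`, to a field of characteristic `p`. -/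
structure ReductionMap (p : ℕ) [Fact p.Prime] (L : Type*) [Field L] [Algebra ℚ L] where
  /-- The subring on which the reduction is defined. -/
  ring : Subring L
  /-- The residue field. -/
  residue : Type
  /-- The field structure of the residue field. -/
  [field : Field residue]
  /-- The residue characteristic is `p`. -/
  [charP : CharP residue p]
  /-- The reduction homomorphism. -/
  map : ring →+* residue
  mem_of_root : ∀ h : ℚ[X], h ≠ 0 → HasGoodCoeffs p h → ∀ x : L, aeval x h = 0 → x ∈ ring
  rat : ∀ q : ℚ, 0 ≤ padicValRat p q →
    ∃ a : ring, (a : L) = algebraMap ℚ L q ∧ map a = ZMod.castHom (dvd_refl p) residue (q : ZMod p)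

attribute [instance] ReductionMap.field ReductionMap.charP

variable {p : ℕ} [Fact p.Prime] {L : Type*} [Field L] [Algebra ℚ L]

/-- Reduction maps exist on algebraic extensions: embed `L` into an algebraic closure of `ℚ_[p]` and
reduce modulo a maximal ideal of the integral closure of `ℤ_[p]`. -/
theorem ReductionMap.nonempty [Algebra.IsAlgebraic ℚ L] : Nonempty (ReductionMap p L) := by
  let Ω := AlgebraicClosure ℚ_[p]
  let O := integralClosure ℤ_[p] Ω
  let j : L →ₐ[ℚ] Ω := IsAlgClosed.lift
  obtain ⟨M, hM⟩ := Ideal.exists_maximal O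
  let κ := O ⧸ M
  let _ : Field κ := Ideal.Quotient.field M
  let π : O →+* κ := Ideal.Quotient.mk M
  have hcomap : M.comap (algebraMap ℤ_[p] O) = IsLocalRing.maximalIdeal ℤ_[p] :=
    IsLocalRing.eq_maximalIdeal (Ideal.isMaximal_comap_of_isIntegral_of_isMaximal M)
  have hπ (x : ℤ_[p]) (hx : PadicInt.toZMod x = 0) : π (algebraMap ℤ_[p] O x) = 0 := by
    rw [← RingHom.mem_ker, PadicInt.ker_toZMod, ← hcomap] at hx
    exact Ideal.Quotient.eq_zero_iff_mem.mpr hx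
  have hchar : CharP κ p := by
    refine (CharP.charP_iff_prime_eq_zero (R := κ) (Fact.out : p.Prime)).mpr ?_
    have h := hπ p (by rw [map_natCast, CharP.cast_eq_zero])
    rwa [map_natCast, map_natCast] at h
  have hcast (x : ℤ_[p]) :
      π (algebraMap ℤ_[p] O x) = ZMod.castHom (dvd_refl p) κ (PadicInt.toZMod x) := by
    obtain ⟨n, hn⟩ := ZMod.natCast_zmod_surjective (PadicInt.toZMod x)
    have h1 := hπ (x - n) (by rw [map_sub, map_natCast, hn, sub_self])
    rw [map_sub, map_sub, sub_eq_zero, map_natCast, map_natCast] at h1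
    rw [h1, ← hn, map_natCast]
  let A : Subring L := (O.toSubring).comap (j : L →+* Ω)
  let φ : A →+* κ := π.comp
    (((j : L →+* Ω).comp A.subtype).codRestrict O.toSubring fun a => a.2)
  refine ⟨⟨A, κ, φ, ?_, ?_⟩⟩
  · intro h h0 hh x hx
    obtain ⟨H, hH, hHu⟩ := hh.exists_model h0
    obtain ⟨H', hm, hass⟩ := exists_monic_of_isUnit_leadingCoeff hHu
    change IsIntegral ℤ_[p] (j x)
    have h1 : H.map (algebraMap ℤ_[p] Ω) = h.map (algebraMap ℚ Ω) := by
      have h2 := congrArg (Polynomial.map (algebraMap ℚ_[p] Ω)) hH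
      rw [Polynomial.map_map, Polynomial.map_map, ← IsScalarTower.algebraMap_eq] at h2
      rw [h2]
      congr 1
    have h3 : eval₂ (algebraMap ℤ_[p] Ω) (j x) H = 0 := by
      rw [eval₂_eq_eval_map, h1, ← eval₂_eq_eval_map]
      change aeval (j x) h = 0
      rw [aeval_algHom_apply, hx, map_zero]
    exact ⟨H', hm, eval₂_eq_zero_of_dvd_of_eval₂_eq_zero _ _ hass.dvd h3⟩
  · intro q hq
    let x : ℤ_[p] := ⟨(q : ℚ_[p]), by
      rwa [Padic.norm_le_one_iff_val_nonneg, Padic.valuation_ratCast]⟩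
    have hjx : j (algebraMap ℚ L q) = algebraMap ℤ_[p] Ω x := by
      rw [j.commutes, IsScalarTower.algebraMap_apply ℤ_[p] ℚ_[p] Ω]
      change _ = algebraMap ℚ_[p] Ω (q : ℚ_[p])
      rw [map_ratCast, eq_ratCast]
    have hmem : algebraMap ℚ L q ∈ A := by
      change IsIntegral ℤ_[p] (j (algebraMap ℚ L q))
      rw [hjx]
      exact isIntegral_algebraMap
    refine ⟨⟨_, hmem⟩, rfl, ?_⟩
    rw [← PadicInt.toZMod_eq_ratCast (x := x) rfl, ← hcast]
    exact congrArg π (Subtype.ext hjx)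

end Reduction

/-! ### Roots modulo `p` and Frobenius -/

section Frobenius

/-- The roots in `𝔽_p` are the roots in an extension that are fixed by the Frobenius. -/
theorem card_roots_eq_countP_pow_eq {p : ℕ} [Fact p.Prime] {κ : Type*} [Field κ] [DecidableEq κ]
    [CharP κ p] (r : (ZMod p)[X]) :
    r.roots.card = (r.map (ZMod.castHom (dvd_refl p) κ)).roots.countP fun x => x ^ p = x := by
  set c := ZMod.castHom (dvd_refl p) κ
  have hrange (x : κ) : x ^ p = x ↔ ∃ a, c a = x := by
    rw [← Subfield.mem_bot_iff_pow_eq_self κ p, ← ZMod.fieldRange_castHom_eq_bot p]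
    rfl
  have key : r.roots.map c = (r.map c).roots.filter fun x => x ^ p = x := by
    ext x
    by_cases hx : x ^ p = x
    · rw [Multiset.count_filter_of_pos (p := fun x => x ^ p = x) hx]
      obtain ⟨a, rfl⟩ := (hrange x).mp hx
      rw [Multiset.count_map_eq_count' _ _ c.injective, count_roots, count_roots,
        eq_rootMultiplicity_map c.injective]
    · rw [Multiset.count_filter_of_neg (p := fun x => x ^ p = x) hx, Multiset.count_eq_zero, Multiset.mem_map]
      rintro ⟨a, -, rfl⟩
      exact hx ((hrange _).mpr ⟨a, rfl⟩)
  rw [Multiset.countP_eq_card_filter, ← key, Multiset.card_map]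

variable {p : ℕ} [Fact p.Prime] {L : Type*} [Field L] [Algebra ℚ L]

theorem ReductionMap.exists_map_aeval (ρ : ReductionMap p L) {q : ℚ[X]}
    (hq : ∀ i, 0 ≤ padicValRat p (q.coeff i)) (z : ρ.ring) :
    ∃ a : ρ.ring, (a : L) = aeval (z : L) q ∧
      ρ.map a = eval₂ (ZMod.castHom (dvd_refl p) ρ.residue) (ρ.map z) (reduceMod p q) := by
  choose c hc hcr using fun i => ρ.rat _ (hq i)
  refine ⟨∑ i ∈ Finset.range (q.natDegree + 1), c i * z ^ i, ?_, ?_⟩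
  · rw [aeval_eq_sum_range]
    push_cast
    exact Finset.sum_congr rfl fun i _ => by rw [hc, Algebra.smul_def]
  · rw [map_sum, eval₂_eq_sum_range' _ (n := q.natDegree + 1)]
    · exact Finset.sum_congr rfl fun i _ => by rw [map_mul, map_pow, hcr, coeff_reduceMod]
    · refine Nat.lt_succ_iff.mpr (natDegree_le_iff_coeff_eq_zero.mpr fun i hi => ?_)
      rw [coeff_reduceMod, coeff_eq_zero_of_natDegree_lt hi, Rat.cast_zero]

/-- The roots of the reduction of `h` are the reductions of the roots of `h`. -/
theorem ReductionMap.exists_roots_map (ρ : ReductionMap p L) {h : ℚ[X]} (h0 : h ≠ 0)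
    (hh : HasGoodCoeffs p h) (hs : (h.map (algebraMap ℚ L)).Splits) :
    ∃ S : Multiset ρ.ring, S.map (fun a : ρ.ring => (a : L)) = h.aroots L ∧
      ((reduceMod p h).map (ZMod.castHom (dvd_refl p) ρ.residue)).roots = S.map ρ.map := by
  have hmem : ∀ x ∈ h.aroots L, x ∈ ρ.ring := fun x hx =>
    ρ.mem_of_root h h0 hh x ((mem_aroots.mp hx).2)
  obtain ⟨S, hS⟩ : ∃ S : Multiset ρ.ring, S.map (fun a : ρ.ring => (a : L)) = h.aroots L :=
    ⟨(h.aroots L).pmap Subtype.mk hmem, by rw [Multiset.map_pmap, Multiset.pmap_eq_map, Multiset.map_id']⟩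
  refine ⟨S, hS, ?_⟩
  obtain ⟨c, hc, hcr⟩ := ρ.rat h.leadingCoeff hh.2.ge
  set H : ρ.ring[X] := C c * (S.map fun a => X - C a).prod with hH
  have hHL : H.map ρ.ring.subtype = h.map (algebraMap ℚ L) := by
    rw [hs.eq_prod_roots, leadingCoeff_map, hH, Polynomial.map_mul, map_C,
      Polynomial.map_multiset_prod, Multiset.map_map]
    change C (c : L) * _ = _
    rw [hc, ← aroots_def, ← hS, Multiset.map_map]
    congr 3
    funext a
    simp
  have hHρ : H.map ρ.map = (reduceMod p h).map (ZMod.castHom (dvd_refl p) ρ.residue) := by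
    ext i
    obtain ⟨a, ha, har⟩ := ρ.rat _ (hh.1 i)
    rw [coeff_map, coeff_map, coeff_reduceMod, ← har]
    congr 1
    apply Subtype.ext
    rw [ha]
    have := congrArg (fun P => P.coeff i) hHL
    rw [coeff_map, coeff_map] at this
    exact this
  have hc0 : ρ.map c ≠ 0 := by
    obtain ⟨F, hF, hFu⟩ := hh.exists_model h0
    rw [hcr]
    refine (_root_.map_ne_zero _).mpr ?_
    have h1 : PadicInt.toZMod F.leadingCoeff = (h.leadingCoeff : ZMod p) := by
      apply PadicInt.toZMod_eq_ratCast
      rw [leadingCoeff, hF.natDegree_eq, hF.coe_coeff, leadingCoeff]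
    rw [← h1]
    exact (hFu.map PadicInt.toZMod).ne_zero
  rw [← hHρ, hH, Polynomial.map_mul, map_C, roots_C_mul _ hc0, Polynomial.map_multiset_prod,
    Multiset.map_map, ← roots_multiset_prod_X_sub_C (S.map ρ.map), Multiset.map_map]
  congr 3
  funext a
  simp

/-- `x` is a polynomial expression in `ζ` with `p`-integral rational coefficients. -/
def IsIntegralExpr (p : ℕ) (ζ x : L) : Prop :=
  ∃ q : ℚ[X], (∀ i, 0 ≤ padicValRat p (q.coeff i)) ∧ aeval ζ q = x

/-- If `σ` raises a root of unity to the `p`-th power, then it induces the `p`-power Frobenius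
modulo `p`, so that the roots of `h` modulo `p` correspond to the roots of `h` fixed by `σ`. The
integrality of the inverses of differences ensures that distinct roots have distinct reductions;
for equal roots it is vacuous, as `0⁻¹ = 0`. -/
theorem rootCount_eq_countP_fixed [DecidableEq L] [Algebra.IsAlgebraic ℚ L] {h : ℚ[X]} (h0 : h ≠ 0)
    (hh : HasGoodCoeffs p h) (hs : (h.map (algebraMap ℚ L)).Splits) {N : ℕ} (hN : 0 < N) {ζ : L}
    (hζ : ζ ^ N = 1) {σ : L ≃ₐ[ℚ] L} (hσ : σ ζ = ζ ^ p)
    (hroots : ∀ α ∈ h.aroots L, IsIntegralExpr p ζ α)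
    (hsep : ∀ α ∈ h.aroots L, ∀ β ∈ h.aroots L, IsIntegralExpr p ζ (α - β)⁻¹) :
    rootCount p h = (h.aroots L).countP fun α => σ α = α := by
  classical
  obtain ⟨ρ⟩ := ReductionMap.nonempty (p := p) (L := L)
  obtain ⟨S, hS, hSr⟩ := ρ.exists_roots_map h0 hh hs
  have hζmem : ζ ∈ ρ.ring := by
    have hgood : HasGoodCoeffs p (X ^ N - 1 : ℚ[X]) := by
      have hm : (X ^ N - 1 : ℚ[X]).Monic := monic_X_pow_sub_C 1 hN.ne'
      refine ⟨fun i => ?_, by rw [hm.leadingCoeff]; simp⟩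
      rw [coeff_sub, coeff_X_pow, coeff_one]
      split_ifs <;> simp
    exact ρ.mem_of_root _ (monic_X_pow_sub_C 1 hN.ne').ne_zero hgood ζ (by simp [hζ])
  let z : ρ.ring := ⟨ζ, hζmem⟩
  have hmemS (a : ρ.ring) (ha : a ∈ S) : (a : L) ∈ h.aroots L := by
    rw [← hS]; exact Multiset.mem_map_of_mem _ ha
  have hfrob (a : ρ.ring) (ha : a ∈ S) : ∃ b ∈ S, (b : L) = σ a ∧ ρ.map b = ρ.map a ^ p := by
    have hσa : σ a ∈ h.aroots L := by
      have h1 := mem_aroots.mp (hmemS a ha)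
      refine mem_aroots.mpr ⟨h1.1, ?_⟩
      rw [aeval_algHom_apply, h1.2, map_zero]
    rw [← hS, Multiset.mem_map] at hσa
    obtain ⟨b, hb, hbσ⟩ := hσa
    refine ⟨b, hb, hbσ, ?_⟩
    obtain ⟨q, hq, hqa⟩ := hroots a (hmemS a ha)
    obtain ⟨a', ha', har⟩ := ρ.exists_map_aeval hq z
    obtain ⟨b', hb', hbr⟩ := ρ.exists_map_aeval hq (z ^ p)
    have haa : a' = a := Subtype.ext (ha'.trans hqa)
    have hbb : b' = b := by
      refine Subtype.ext (hb'.trans ?_)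
      rw [hbσ, ← hqa, ← aeval_algHom_apply]
      change aeval (ζ ^ p) q = aeval (σ ζ) q
      rw [hσ]
    rw [← haa, ← hbb, har, hbr, map_pow, eval₂_eq_eval_map, eval₂_eq_eval_map, ← expand_eval,
      ← map_expand, ZMod.expand_card, Polynomial.map_pow, eval_pow]
  have hinj (a b : ρ.ring) (ha : a ∈ S) (hb : b ∈ S) (hab : ρ.map a = ρ.map b) : a = b := by
    by_contra hne
    obtain ⟨q, hq, hqa⟩ := hsep a (hmemS a ha) b (hmemS b hb)
    obtain ⟨c, hc, -⟩ := ρ.exists_map_aeval hq z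
    have h1 : c * (a - b) = 1 := by
      apply Subtype.ext
      push_cast
      rw [hc]
      change aeval ζ q * _ = 1
      rw [hqa]
      exact inv_mul_cancel₀ (sub_ne_zero.mpr fun h => hne (Subtype.ext h))
    have h2 := congrArg ρ.map h1
    rw [map_mul, map_sub, hab, sub_self, mul_zero, map_one] at h2
    exact zero_ne_one h2
  rw [rootCount, card_roots_eq_countP_pow_eq (κ := ρ.residue), hSr, ← hS, Multiset.countP_map,
    Multiset.countP_map]
  congr 1
  refine Multiset.filter_congr fun a ha => ?_
  obtain ⟨b, hb, hbσ, hbr⟩ := hfrob a ha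
  rw [← hbr, ← hbσ]
  exact ⟨fun h => congrArg _ (hinj b a hb ha h), fun h => congrArg _ (Subtype.ext h)⟩

end Frobenius

/-! ### Properties of almost all primes -/

section AlmostAllPrimes

open Filter

theorem eventually_padicValRat_eq_zero (r : ℚ) : ∀ᶠ p : ℕ in atTop, padicValRat p r = 0 := by
  rcases eq_or_ne r 0 with rfl | hr
  · simp
  filter_upwards [eventually_gt_atTop r.num.natAbs, eventually_gt_atTop r.den] with p h1 h2
  rw [padicValRat_def, padicValInt, padicValNat.eq_zero_of_not_dvd
    (Nat.not_dvd_of_pos_of_lt (Int.natAbs_pos.mpr (Rat.num_ne_zero.mpr hr)) h1),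
    padicValNat.eq_zero_of_not_dvd (Nat.not_dvd_of_pos_of_lt r.den_pos h2)]
  simp

theorem eventually_padicValRat_coeff_eq_zero (q : ℚ[X]) :
    ∀ᶠ p : ℕ in atTop, ∀ i, padicValRat p (q.coeff i) = 0 := by
  have h := (eventually_all_finset (l := atTop) q.support).mpr fun i _ =>
    eventually_padicValRat_eq_zero (q.coeff i)
  filter_upwards [h] with p hp i
  by_cases hi : i ∈ q.support
  · exact hp i hi
  · rw [notMem_support_iff.mp hi, padicValRat.zero]

theorem eventually_hasGoodCoeffs (q : ℚ[X]) : ∀ᶠ p : ℕ in atTop, HasGoodCoeffs p q :=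
  (eventually_padicValRat_coeff_eq_zero q).mono fun _ h => ⟨fun i => (h i).ge, h _⟩

/-- A squarefree rational polynomial remains squarefree modulo almost all primes, by reduction of a
Bézout relation between the polynomial and its derivative. -/
theorem eventually_squarefree_reduceMod {r : ℚ[X]} (hr : Squarefree r) :
    ∀ᶠ p : ℕ in atTop, ∀ _ : Fact p.Prime, Squarefree (reduceMod p r) := by
  obtain ⟨a, b, hab⟩ := PerfectField.separable_iff_squarefree.mpr hr
  filter_upwards [eventually_hasGoodCoeffs a, eventually_hasGoodCoeffs b,
    eventually_hasGoodCoeffs r] with p ha hb hr _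
  obtain ⟨A, hA⟩ := exists_isPadicModel ha.1
  obtain ⟨B, hB⟩ := exists_isPadicModel hb.1
  obtain ⟨R, hR⟩ := exists_isPadicModel hr.1
  have h1 : A * R + B * derivative R = 1 := by
    apply map_injective _ (IsFractionRing.injective ℤ_[p] ℚ_[p])
    have h2 := congrArg (Polynomial.map (algebraMap ℚ ℚ_[p])) hab
    unfold IsPadicModel at hA hB hR
    rw [Polynomial.map_add, Polynomial.map_mul, Polynomial.map_mul, ← derivative_map,
      Polynomial.map_one] at h2 ⊢
    rw [hA, hB, hR, h2]
  have h3 := congrArg (Polynomial.map PadicInt.toZMod) h1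
  rw [Polynomial.map_add, Polynomial.map_mul, Polynomial.map_mul, ← derivative_map,
    Polynomial.map_one] at h3
  rw [hR.reduceMod_eq]
  exact Separable.squarefree ⟨_, _, h3⟩

theorem eventually_isHenselPrime (f g : ℚ[X]) :
    ∀ᶠ p : ℕ in atTop, ∀ _ : Fact p.Prime, IsHenselPrime p f g := by
  filter_upwards [eventually_hasGoodCoeffs f, eventually_hasGoodCoeffs g,
    eventually_squarefree_reduceMod (UniqueFactorizationMonoid.squarefree_radical (a := f * g))]
    with p hf hg hs hp
  exact ⟨hf, hg, hs hp⟩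

theorem eventually_isIntegralExpr {L : Type*} [Field L] [Algebra ℚ L] {ζ x : L}
    (hx : x ∈ Algebra.adjoin ℚ {ζ}) : ∀ᶠ p : ℕ in atTop, IsIntegralExpr p ζ x := by
  rw [Algebra.adjoin_singleton_eq_range_aeval] at hx
  obtain ⟨q, hq⟩ := hx
  filter_upwards [eventually_padicValRat_coeff_eq_zero q] with p hp
  exact ⟨q, fun i => (hp i).ge, hq⟩

end AlmostAllPrimes

/-! ### Stabilizers of roots -/

section Stabilizers

variable {L : Type*} [Field L] [Algebra ℚ L]

/-- The subgroup of the Galois group of `P` consisting of the restrictions of the automorphisms of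
`L` that fix `α`. -/
def rootStabilizer (P : ℚ[X]) (L : Type*) [Field L] [Algebra ℚ L]
    [Fact (P.map (algebraMap ℚ L)).Splits] (α : L) : Subgroup P.Gal :=
  (MulAction.stabilizer (L ≃ₐ[ℚ] L) α).map (Gal.restrict P L)

variable {P : ℚ[X]} [Fact (P.map (algebraMap ℚ L)).Splits]

theorem ker_restrict_le_stabilizer {α : L} (hα : α ∈ P.rootSet L) :
    (Gal.restrict P L).ker ≤ MulAction.stabilizer (L ≃ₐ[ℚ] L) α := by
  intro τ hτ
  have h1 := Gal.restrict_smul (p := P) (E := L) τ ⟨α, hα⟩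
  rw [MonoidHom.mem_ker.mp hτ, one_smul] at h1
  exact h1.symm

theorem restrict_mem_rootStabilizer {α : L} (hα : α ∈ P.rootSet L) (σ : L ≃ₐ[ℚ] L) :
    Gal.restrict P L σ ∈ rootStabilizer P L α ↔ σ α = α := by
  rw [← Subgroup.mem_comap, rootStabilizer,
    Subgroup.comap_map_eq_self (ker_restrict_le_stabilizer hα), MulAction.mem_stabilizer_iff]
  rfl

/-- The index is the number of conjugates of `α`. -/
theorem index_rootStabilizer_le [Normal ℚ L] {α : L} (hα : α ∈ P.rootSet L) :
    (rootStabilizer P L α).index ≤ (minpoly ℚ α).natDegree := by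
  rw [rootStabilizer, Subgroup.index_map_eq _ (Gal.restrict_surjective P L)
    (ker_restrict_le_stabilizer hα), MulAction.index_stabilizer]
  have hint : IsIntegral ℚ α := Normal.isIntegral inferInstance α
  have hsub : MulAction.orbit (L ≃ₐ[ℚ] L) α ⊆ (minpoly ℚ α).rootSet L := by
    rintro _ ⟨σ, rfl⟩
    refine mem_rootSet.mpr ⟨minpoly.ne_zero hint, ?_⟩
    change aeval (σ α) _ = 0
    rw [aeval_algHom_apply, minpoly.aeval, map_zero]
  refine (Set.ncard_le_ncard hsub (rootSet_finite _ _)).trans ?_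
  classical
  rw [rootSet, Set.ncard_coe_finset]
  exact (Multiset.toFinset_card_le _).trans ((card_roots' _).trans natDegree_map_le)

theorem adjoin_eq_adjoin_of_rootStabilizer_eq [FiniteDimensional ℚ L] [IsGalois ℚ L] {α β : L}
    (hα : α ∈ P.rootSet L) (hβ : β ∈ P.rootSet L)
    (h : rootStabilizer P L α = rootStabilizer P L β) :
    IntermediateField.adjoin ℚ {α} = IntermediateField.adjoin ℚ {β} := by
  have key (a b : L) (hab : ∀ σ : L ≃ₐ[ℚ] L, σ a = a → σ b = b) :
      IntermediateField.adjoin ℚ {b} ≤ IntermediateField.adjoin ℚ {a} := by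
    rw [IntermediateField.adjoin_simple_le_iff,
      ← IsGalois.fixedField_fixingSubgroup (IntermediateField.adjoin ℚ {a})]
    rintro ⟨σ, hσ⟩
    exact hab σ (hσ ⟨a, IntermediateField.mem_adjoin_simple_self ℚ a⟩)
  have hiff (σ : L ≃ₐ[ℚ] L) : σ α = α ↔ σ β = β := by
    rw [← restrict_mem_rootStabilizer hα, h, restrict_mem_rootStabilizer hβ]
  exact le_antisymm (key β α fun σ => (hiff σ).mpr) (key α β fun σ => (hiff σ).mp)

/-- If every automorphism fixes as many roots of `f` as of `g`, and if the stabilizers have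
index at most two or lie in a cyclic group, then the root fields of `f` and `g` match. -/
theorem rootFieldsMatch_of_countP_eq [DecidableEq L] [FiniteDimensional ℚ L] [IsGalois ℚ L]
    {f g : ℚ[X]} (hf : f ≠ 0) (hg : g ≠ 0) (hfg : f * g = P)
    (hP : (∀ q : ℚ[X], Irreducible q → q ∣ P → q.natDegree ≤ 2) ∨ IsCyclic P.Gal)
    (h : ∀ σ : L ≃ₐ[ℚ] L,
      (f.aroots L).countP (fun α => σ α = α) = (g.aroots L).countP fun α => σ α = α) :
    RootFieldsMatch f g := by
  classical
  have hP0 : P ≠ 0 := hfg ▸ mul_ne_zero hf hg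
  have hsplit : (P.map (algebraMap ℚ L)).Splits := Fact.out
  have hmem (q : ℚ[X]) (hq : q ∣ P) (α : L) (hα : α ∈ q.aroots L) : α ∈ P.rootSet L :=
    mem_rootSet.mpr ⟨hP0, aeval_eq_zero_of_dvd_aeval_eq_zero hq (mem_aroots.mp hα).2⟩
  have hfP : f ∣ P := ⟨g, hfg.symm⟩
  have hgP : g ∣ P := ⟨f, by rw [mul_comm, hfg]⟩
  have hcount (s : P.Gal) : ((f.aroots L).map (rootStabilizer P L)).countP (s ∈ ·) =
      ((g.aroots L).map (rootStabilizer P L)).countP (s ∈ ·) := by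
    obtain ⟨σ, rfl⟩ := Gal.restrict_surjective P L s
    have h1 (q : ℚ[X]) (hq : q ∣ P) :
        ((q.aroots L).map (rootStabilizer P L)).countP (Gal.restrict P L σ ∈ ·) =
          (q.aroots L).countP fun α => σ α = α := by
      rw [Multiset.countP_map, Multiset.countP_eq_card_filter]
      congr 1
      exact Multiset.filter_congr fun α hα => restrict_mem_rootStabilizer (hmem q hq α hα) σ
    rw [h1 f hfP, h1 g hgP, h σ]
  have hAB : (f.aroots L).map (rootStabilizer P L) = (g.aroots L).map (rootStabilizer P L) := by
    rcases hP with hP | hP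
    · have hindex (q : ℚ[X]) (hq : q ∣ P) (H) (hH : H ∈ (q.aroots L).map (rootStabilizer P L)) :
          H.index ≤ 2 := by
        obtain ⟨α, hα, rfl⟩ := Multiset.mem_map.mp hH
        have hint : IsIntegral ℚ α := Normal.isIntegral inferInstance α
        exact (index_rootStabilizer_le (hmem q hq α hα)).trans (hP _ (minpoly.irreducible hint)
          ((minpoly.dvd ℚ α (mem_aroots.mp hα).2).trans hq))
      exact Multiset.eq_of_countP_mem_eq_of_index_le_two (hindex f hfP) (hindex g hgP) hcount
    · exact Multiset.eq_of_countP_mem_eq_of_isCyclic hcount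
  let j : L →ₐ[ℚ] ℂ := IsAlgClosed.lift
  have hj (q : ℚ[X]) (hq : q ∣ P) : q.aroots ℂ = (q.aroots L).map j := by
    have h1 : (q.map (algebraMap ℚ L)).Splits :=
      hsplit.of_dvd (map_ne_zero hP0) (Polynomial.map_dvd _ hq)
    have h2 := h1.roots_map (j : L →+* ℂ)
    rw [Polynomial.map_map, AlgHom.comp_algebraMap] at h2
    exact h2
  rw [RootFieldsMatch, hj f hfP, hj g hgP, Multiset.rel_map]
  rw [← Multiset.rel_eq, Multiset.rel_map] at hAB
  refine hAB.mono fun α hα β hβ hαβ => ?_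
  have h1 := adjoin_eq_adjoin_of_rootStabilizer_eq (hmem f hfP α hα) (hmem g hgP β hβ) hαβ
  have h2 := congrArg (IntermediateField.map j) h1
  rwa [IntermediateField.adjoin_map, IntermediateField.adjoin_map, Set.image_singleton,
    Set.image_singleton] at h2

end Stabilizers

/-! ### Infinitely many asymmetric primes -/

section Main

/-- If only finitely many primes were asymmetric, then each automorphism of the cyclotomic field,
being the Frobenius of some large prime, would fix as many roots of `f` as of `g`. -/
theorem infinite_setOf_isAsymmetric {f g P : ℚ[X]} (hf : f ≠ 0) (hg : g ≠ 0) (hfg : f * g = P)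
    (hP : (∀ q : ℚ[X], Irreducible q → q ∣ P → q.natDegree ≤ 2) ∨
      (IsCyclic P.Gal ∧
        ∃ N : ℕ, 0 < N ∧ (P.map (algebraMap ℚ (CyclotomicField N ℚ))).Splits))
    (hmatch : ¬ RootFieldsMatch f g) :
    {p : ℕ | ∃ _ : Fact p.Prime, IsAsymmetric p f g}.Infinite := by
  classical
  have hP0 : P ≠ 0 := hfg ▸ mul_ne_zero hf hg
  obtain ⟨N, hN, hsplit⟩ : ∃ N : ℕ, 0 < N ∧
      (P.map (algebraMap ℚ (CyclotomicField N ℚ))).Splits := by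
    rcases hP with hP | hP
    · exact exists_splits_cyclotomicField_of_natDegree_le_two hP0 hP
    · exact hP.2
  have : NeZero N := ⟨hN.ne'⟩
  have : NeZero (N : ℚ) := ⟨by exact_mod_cast hN.ne'⟩
  set L := CyclotomicField N ℚ
  have hcyc : IsCyclotomicExtension {N} ℚ L := CyclotomicField.isCyclotomicExtension N ℚ
  have hnf : NumberField L := IsCyclotomicExtension.numberField {N} ℚ L
  have hgal : IsGalois ℚ L := IsCyclotomicExtension.isGalois {N} ℚ L
  have : Fact (P.map (algebraMap ℚ L)).Splits := ⟨hsplit⟩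
  intro hfin
  refine hmatch (rootFieldsMatch_of_countP_eq (L := L) hf hg hfg (hP.imp_right And.left) fun σ => ?_)
  have hζ := IsCyclotomicExtension.zeta_spec N ℚ L
  set ζ := IsCyclotomicExtension.zeta N ℚ L
  have hadjoin (x : L) : x ∈ Algebra.adjoin ℚ {ζ} := by
    rw [IsCyclotomicExtension.adjoin_primitive_root_eq_top hζ]; trivial
  set T : Finset L := (P.aroots L).toFinset with hT
  have h1 : ∀ᶠ p : ℕ in Filter.atTop, ∀ α ∈ T, IsIntegralExpr p ζ α :=
    (Filter.eventually_all_finset T).mpr fun α _ => eventually_isIntegralExpr (hadjoin α)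
  have h2 : ∀ᶠ p : ℕ in Filter.atTop, ∀ α ∈ T, ∀ β ∈ T, IsIntegralExpr p ζ (α - β)⁻¹ :=
    (Filter.eventually_all_finset T).mpr fun α _ => (Filter.eventually_all_finset T).mpr fun β _ =>
      eventually_isIntegralExpr (hadjoin _)
  have h3 : ∀ᶠ p : ℕ in Filter.atTop, p ∉ {p : ℕ | ∃ _ : Fact p.Prime, IsAsymmetric p f g} := by
    rw [← Nat.cofinite_eq_atTop]
    exact hfin.compl_mem_cofinite
  obtain ⟨n, hn⟩ := Filter.eventually_atTop.mp
    (h1.and (h2.and (h3.and (eventually_isHenselPrime f g))))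
  set a := IsCyclotomicExtension.Rat.galEquivZMod N L σ with ha
  -- Dirichlet's theorem provides a prime whose Frobenius on the roots of unity is `σ`.
  obtain ⟨p, hpn, hp, hpa⟩ := Nat.forall_exists_prime_gt_and_eq_mod a.isUnit n
  obtain ⟨hroots, hsep, hasym, hhensel⟩ := hn p hpn.le
  have hpf : Fact p.Prime := ⟨hp⟩
  have hH := hhensel hpf
  have hσ : σ ζ = ζ ^ p := by
    rw [IsCyclotomicExtension.Rat.galEquivZMod_apply_of_pow_eq N L σ hζ.pow_eq_one, ← ha, ← hpa,
      ZMod.val_natCast, ← pow_mod_orderOf ζ p, ← hζ.eq_orderOf]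
  have hcount (q : ℚ[X]) (hq : q ∣ P) (hgood : HasGoodCoeffs p q) :
      rootCount p q = (q.aroots L).countP fun α => σ α = α := by
    have hmem (α : L) (hα : α ∈ q.aroots L) : α ∈ T := by
      rw [hT, Multiset.mem_toFinset, mem_aroots]
      exact ⟨hP0, aeval_eq_zero_of_dvd_aeval_eq_zero hq (mem_aroots.mp hα).2⟩
    exact rootCount_eq_countP_fixed (ne_zero_of_dvd_ne_zero hP0 hq) hgood
      (hsplit.of_dvd (map_ne_zero hP0) (Polynomial.map_dvd _ hq)) hN hζ.pow_eq_one hσ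
      (fun α hα => hroots α (hmem α hα))
      (fun α hα β hβ => hsep α (hmem α hα) β (hmem β hβ))
  rw [← hcount f ⟨g, hfg.symm⟩ hH.good_f, ← hcount g ⟨f, by rw [mul_comm, hfg]⟩ hH.good_g]
  by_contra hne
  exact hasym ⟨hpf, hH, hne⟩

end Main

end

theorem theorem2 (P : ℚ[X])
    (hP : (∀ q : ℚ[X], Irreducible q → q ∣ P → q.natDegree ≤ 2) ∨
      (IsCyclic P.Gal ∧
        ∃ N : ℕ, 0 < N ∧ (P.map (algebraMap ℚ (CyclotomicField N ℚ))).Splits)) :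
    ∃ B : ℕ → ℝ, ∀ (f g : ℚ[X]) (u : ℕ → ℚ), f * g = P → ClassD f g u →
      {p : ℕ | ∃ _ : Fact p.Prime, IsAsymmetric p f g}.Infinite ∧
      ∀ (p : ℕ) [Fact p.Prime], IsAsymmetric p f g →
        (∀ n : ℕ, |(padicValRat p (u n) : ℝ) - (padicValRat p (u 0) : ℝ)
            - valuationRate p f g * (n : ℝ)| ≤ B p * Real.log ((n : ℝ) + 1)) ∧
        ∃ n₀ : ℕ, ∀ n : ℕ, n₀ ≤ n →
          |valuationRate p f g| / 2 * (n : ℝ) ≤ |(padicValRat p (u n) : ℝ)| ∧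
          |valuationRate p f g| * Real.log (p : ℝ) / 2 * (n : ℝ) ≤ Height.logHeight₁ (u n) := by
  classical
  refine ⟨fun p => if hp : p.Prime then
    haveI : Fact p.Prime := ⟨hp⟩
    (exists_valuation_error_bound P p).choose else 0, fun f g u hfg hu => ⟨?_, ?_⟩⟩
  · exact infinite_setOf_isAsymmetric hu.hypergeometric.f_nonzero hu.hypergeometric.g_nonzero hfg hP
      hu.not_match
  · intro p hp hasym
    have hB := (exists_valuation_error_bound P p).choose_spec f g u hfg hu hasym.1
    refine ⟨fun n => ?_, ?_⟩
    · simp only [dif_pos hp.out]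
      exact hB n
    · obtain ⟨n₀, hn₀⟩ := exists_half_mul_le_abs (v := fun n => (padicValRat p (u n) : ℝ))
        (valuationRate_ne_zero hasym) hB
      refine ⟨n₀, fun n hn => ⟨hn₀ n hn, ?_⟩⟩
      refine le_trans ?_ (abs_padicValRat_mul_log_le_logHeight₁ p (hu.ne_zero n))
      have h := mul_le_mul_of_nonneg_right (hn₀ n hn) (Real.log_natCast_nonneg p)
      linarith
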